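/- For an open, possibly unbounded, interval $\tilde J\subset\mathbb R$ let $\mathbb C_{\tilde J}=(\mathbb C\setminus\mathbb R)\cup\tilde J$. An orientation preserving homeomorphism $g:I=[0,a]\to J=g(I)$ of real intervals is in the Epstein class if it extends to a three-fold analytic branched covering, also denoted $g$, of an open simply connected domain $G\subset\mathbb C$, $G\supset I$, onto $\mathbb C_{\tilde J}$ for some such $\tilde J\supset J$, with its only branch point at $0$. For $s\in(0,1)$ let $\mathcal E_s$ be the set of those $g$ for which $$ s\le \frac{|I|}{|J|}\le s^{-1},\qquad s\le\frac{\operatorname{dist}(I,J)}{|J|}\le s^{-1}, $$ each component of $\tilde J\setminus J$ has length at least $s|J|$, and $g'(a)>s$; let $\overline{\mathcal E}_s\supset\mathcal E_s$ be the set defined in the same way with $g'(a)\ge s$ in place of $g'(a)>s$. Each such map is regarded as a triple $(G,0,g)$ with marked domain $(G,0)$. A sequence of triples $(U_n,u_n,f_n)$ converges to $(U,u,f)$ if the marked domains converge in the sense of Carathéodory ($u_n\to u\in U$ and, for every Hausdorff limit point $K$ of the sequence $\hat{\mathbb C}\setminus U_n$, the set $U$ is a connected component of $\hat{\mathbb C}\setminus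 K$), and $f_n\to f$ locally uniformly on $U$ (every compact subset of $U$ lies in $U_n$ for all large $n$, and $f_n\to f$ uniformly on it). Let $s\in(0,1)$. Then every sequence of maps in $\mathcal E_s$ with $I=[0,1]$ has a subsequence that converges to a map in $\overline{\mathcal E}_s$ with $I=[0,1]$. Moreover, the set of maps in $\overline{\mathcal E}_s$ with $I=[0,1]$ is sequentially compact: every sequence in it has a subsequence that converges to an element of it. -/

import Mathlib

open Set Filter Topology MeasureTheory

namespace Epstein

/-- A triple `(U, u, f)`: a domain `U ⊆ ℂ`, a marked point `u`, and a map `f` of which only the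
values on `U` matter. -/
structure MarkedMap where
  dom : Set ℂ
  pt : ℂ
  map : ℂ → ℂ

/-- The plane `ℂ_J = (ℂ \ ℝ) ∪ J`. -/
def slitPlane (J : Set ℝ) : Set ℂ :=
  {z | z.im ≠ 0} ∪ (fun x : ℝ => (x : ℂ)) '' J

/-- `f : U → V` is a `d`-fold analytic branched covering map (a proper holomorphic map which takes
every value in `V` exactly `d` times, counted with multiplicity). -/
structure IsBranchedCovering (d : ℕ) (f : ℂ → ℂ) (U V : Set ℂ) : Prop where
  analytic : DifferentiableOn ℂ f U
  mapsTo : MapsTo f U V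
  proper : ∀ L ⊆ V, IsCompact L → IsCompact (U ∩ f ⁻¹' L)
  degree : ∀ w ∈ V,
    ∑ᶠ z ∈ {z | z ∈ U ∧ f z = w}, analyticOrderNatAt (fun x => f x - w) z = d

/-- The orientation preserving homeomorphism `g : I = [0,a] → J = g(I)` extends to a three-fold
analytic branched covering `f` of the topological disk `G ⊇ I` onto the slit plane of the open,
possibly unbounded, interval `Jt ⊇ J`, with its only branch point at `0`. -/
structure IsEpsteinMap (a : ℝ) (g : ℝ → ℝ) (Jt : Set ℝ) (G : Set ℂ) (f : ℂ → ℂ) : Prop where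
  ne_zero : a ≠ 0
  strictMono : StrictMonoOn g (uIcc 0 a)
  continuousOn : ContinuousOn g (uIcc 0 a)
  isOpen_range : IsOpen Jt
  interval_range : Jt.OrdConnected
  image_subset : g '' uIcc 0 a ⊆ Jt
  isOpen_dom : IsOpen G
  simplyConnected_dom : IsSimplyConnected G
  subset_dom : ∀ x ∈ uIcc 0 a, (x : ℂ) ∈ G
  extends_map : ∀ x ∈ uIcc 0 a, f x = g x
  covering : IsBranchedCovering 3 f G (slitPlane Jt)
  branch : ∀ z ∈ G, deriv f z = 0 ↔ z = 0

/-- `x` and `y` are `K`-commensurable. -/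
def Commensurable (K x y : ℝ) : Prop :=
  K⁻¹ ≤ |x| / |y| ∧ |x| / |y| ≤ K

/-- The Euclidean distance between two sets of reals. -/
noncomputable def setDist (A B : Set ℝ) : ℝ :=
  sInf (image2 dist A B)

/-- The metric conditions on `g : I = [0,a] → J ⊆ Jt` in the definition of the class `E_s`, apart
from the condition on the derivative at `a`. -/
structure HasBounds (s a : ℝ) (g : ℝ → ℝ) (Jt : Set ℝ) : Prop where
  length : Commensurable s⁻¹ (Metric.diam (uIcc 0 a)) (Metric.diam (g '' uIcc 0 a))
  distance : Commensurable s⁻¹ (setDist (uIcc 0 a) (g '' uIcc 0 a))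
    (Metric.diam (g '' uIcc 0 a))
  space : ∀ x ∈ Jt \ g '' uIcc 0 a,
    ENNReal.ofReal (s * Metric.diam (g '' uIcc 0 a)) ≤
      volume (connectedComponentIn (Jt \ g '' uIcc 0 a) x)

/-- The maps of the class `E_s` with `I = [0,a]`, as triples `(G, 0, f)`. -/
def epsteinClass (s a : ℝ) : Set MarkedMap :=
  {T | T.pt = 0 ∧ ∃ (g : ℝ → ℝ) (Jt : Set ℝ), IsEpsteinMap a g Jt T.dom T.map ∧
    HasBounds s a g Jt ∧ s < derivWithin g (uIcc 0 a) a}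

/-- The same class with `g'(a) ≥ s` in place of `g'(a) > s`. -/
def closedEpsteinClass (s a : ℝ) : Set MarkedMap :=
  {T | T.pt = 0 ∧ ∃ (g : ℝ → ℝ) (Jt : Set ℝ), IsEpsteinMap a g Jt T.dom T.map ∧
    HasBounds s a g Jt ∧ s ≤ derivWithin g (uIcc 0 a) a}

/-- The complement of `U ⊆ ℂ` in the Riemann sphere. -/
def sphereCompl (U : Set ℂ) : Set (OnePoint ℂ) :=
  ((fun z : ℂ => (z : OnePoint ℂ)) '' U)ᶜ

/-- `K` is a Hausdorff limit point of the sequence `A` of compact subsets of the Riemann sphere: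
`K` is compact and some subsequence of `A` converges to `K`. On the nonempty compact subsets of the
sphere the Vietoris topology is the topology of the Hausdorff distance. -/
def IsHausdorffLimitPoint (A : ℕ → Set (OnePoint ℂ)) (K : Set (OnePoint ℂ)) : Prop :=
  IsCompact K ∧ ∃ φ : ℕ → ℕ, StrictMono φ ∧
    Tendsto (A ∘ φ) atTop (@nhds _ (TopologicalSpace.vietoris (OnePoint ℂ)) K)

/-- Carathéodory convergence of the marked regions `(U n, u n)` to `(V, v)`: `u n → v ∈ V` and, for
each Hausdorff limit point `K` of the complements of the `U n` in the sphere, `V` is a connected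
component of the complement of `K`. -/
def CaratheodoryConverges (U : ℕ → Set ℂ) (u : ℕ → ℂ) (V : Set ℂ) (v : ℂ) : Prop :=
  Tendsto u atTop (𝓝 v) ∧ v ∈ V ∧
    ∀ K, IsHausdorffLimitPoint (fun n => sphereCompl (U n)) K →
      (fun z : ℂ => (z : OnePoint ℂ)) '' V = connectedComponentIn Kᶜ (v : OnePoint ℂ)

/-- Convergence of triples: Carathéodory convergence of the marked domains together with locally
uniform convergence of the maps, that is, each compact subset of the limit domain is eventually
contained in the domains of the sequence and the maps converge uniformly on it. -/
def ConvergesTo (T : ℕ → MarkedMap) (S : MarkedMap) : Prop :=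
  CaratheodoryConverges (fun n => (T n).dom) (fun n => (T n).pt) S.dom S.pt ∧
    ∀ L ⊆ S.dom, IsCompact L → (∀ᶠ n in atTop, L ⊆ (T n).dom) ∧
      TendstoUniformlyOn (fun n => (T n).map) S.map atTop L

end Epstein

/-!
A map of the class is determined by a univalent parametrization of its domain. Since the slit plane
`V` of `J` is star-shaped about `c = g 0`, the path lifting property gives a univalent `ψ` from the
region `{ζ | ζ ^ 3 + c ∈ V}` onto `G` with `f (ψ ζ) = ζ ^ 3 + c`. Rotating `ζ` by a cube root of
unity we may assume `ψ 0 = 0` and `ψ l = 1`, where `l ^ 3 = |g(I)|`. The metric conditions confine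
`c` and `l` to compact sets, keep `l` away from `0`, and are closed conditions on `c`, `l` and the
end points of `J`, so all of these converge along a subsequence.

Univalent functions with two prescribed values form a normal family: where `ψ` omits a value `v`,
`ψ - v` has a logarithm whose image contains no disk of radius `4 > π`, so Bloch's theorem bounds
its derivative. By Hurwitz's theorem the limits `Ψ` are univalent, and univalent convergence carries
the kernel convergence of the regions `{ζ | ζ ^ 3 + c ∈ V}` over to the domains `G`. There `f`
converges to `Ψ⁻¹ ^ 3 + c`, which is a branched covering with the uniformization `Ψ`.
-/

namespace Epstein

open Metric

section Distortion

variable {L h : ℂ → ℂ} {a p v z : ℂ} {r R ρ : ℝ} {S : Set ℂ}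

theorem norm_sub_sub_le_of_norm_deriv_le (hL : DifferentiableOn ℂ L (ball p R))
    (hderiv : ∀ z ∈ ball p R, ‖deriv L z‖ ≤ 2 * ‖deriv L p‖) (hz : z ∈ closedBall p (R / 6)) :
    ‖L z - L p - deriv L p * (z - p)‖ ≤ ‖deriv L p‖ / 2 * ‖z - p‖ := by
  rcases le_or_gt R 0 with hR | hR
  · have hzp : z = p := by
      rw [← dist_le_zero]
      exact (mem_closedBall.1 hz).trans (by linarith)
    simp [hzp]
  have hsub : closedBall p (R / 6) ⊆ ball p R := closedBall_subset_ball (by linarith)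
  have hmaps : MapsTo (deriv L) (ball p R) (closedBall (deriv L p) (3 * ‖deriv L p‖)) :=
    fun w hw => mem_closedBall_iff_norm.2 <|
      (norm_sub_le _ _).trans (by linarith [hderiv w hw])
  have hderiv_sub : ∀ w ∈ closedBall p (R / 6), ‖deriv L w - deriv L p‖ ≤ ‖deriv L p‖ / 2 := by
    intro w hw
    rw [← dist_eq_norm]
    calc dist (deriv L w) (deriv L p) ≤ 3 * ‖deriv L p‖ / R * dist w p :=
          Complex.dist_le_div_mul_dist_of_mapsTo_ball (hL.deriv isOpen_ball) hmaps (hsub hw)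
      _ ≤ 3 * ‖deriv L p‖ / R * (R / 6) := by gcongr; exact mem_closedBall.1 hw
      _ = ‖deriv L p‖ / 2 := by field_simp; ring
  have hlin : ∀ w ∈ closedBall p (R / 6), HasDerivWithinAt (fun w => L w - deriv L p * w)
      (deriv L w - deriv L p) (closedBall p (R / 6)) w := by
    intro w hw
    have hLw := (hL.differentiableAt (isOpen_ball.mem_nhds (hsub hw))).hasDerivAt
    simpa using (hLw.fun_sub ((hasDerivAt_id w).const_mul (deriv L p))).hasDerivWithinAt
  have hlip := (convex_closedBall p (R / 6)).norm_image_sub_le_of_norm_hasDerivWithin_le hlin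
    hderiv_sub (mem_closedBall_self (by linarith)) hz
  rwa [sub_sub_sub_comm, ← mul_sub] at hlip

theorem ball_subset_image_ball_of_norm_deriv_le (hL : DifferentiableOn ℂ L (ball p R))
    (hderiv : ∀ z ∈ ball p R, ‖deriv L z‖ ≤ 2 * ‖deriv L p‖) :
    ball (L p) (‖deriv L p‖ * R / 24) ⊆ L '' ball p R := by
  intro w hw
  have hpos : 0 < ‖deriv L p‖ * R := by linarith [pos_of_mem_ball hw]
  have hderiv_pos : 0 < ‖deriv L p‖ := (norm_nonneg _).lt_of_ne (left_ne_zero_of_mul hpos.ne').symm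
  have hR : 0 < R := pos_of_mul_pos_right hpos hderiv_pos.le
  have hsub : closedBall p (R / 6) ⊆ ball p R := closedBall_subset_ball (by linarith)
  have hsphere : ∀ z ∈ sphere p (R / 6), ‖deriv L p‖ * R / 12 ≤ ‖L z - L p‖ := by
    intro z hz
    have hlin := norm_sub_sub_le_of_norm_deriv_le hL hderiv (sphere_subset_closedBall hz)
    have htri := norm_sub_le (L z - L p) (L z - L p - deriv L p * (z - p))
    rw [sub_sub_cancel, norm_mul] at htri
    rw [mem_sphere_iff_norm.1 hz] at hlin htri
    linarith
  have hne : ∃ᶠ z in 𝓝 p, L z ≠ L p := by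
    intro hconst
    have hLp : L =ᶠ[𝓝 p] fun _ => L p := hconst.mono fun z hz => not_not.1 hz
    simp [hLp.deriv_eq] at hderiv_pos
  have hdiff : DiffContOnCl ℂ L (ball p (R / 6)) :=
    DifferentiableOn.diffContOnCl (hL.mono (closure_ball_subset_closedBall.trans hsub))
  refine image_mono hsub (hdiff.ball_subset_image_closedBall (by linarith) hsphere hne ?_)
  convert hw using 2
  ring

theorem exists_ball_subset_image_of_lt_norm_deriv (hr : 0 < r)
    (hL : DifferentiableOn ℂ L (ball a r)) (h : 96 * ρ < ‖deriv L a‖ * r) :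
    ∃ p, ball p ρ ⊆ L '' ball a r := by
  have hsub : closedBall a (r / 2) ⊆ ball a r := closedBall_subset_ball (by linarith)
  -- At a maximum point of this weight, `‖deriv L‖` is at most doubled on a comparable disk.
  obtain ⟨p, hp, hmax⟩ := (isCompact_closedBall a (r / 2)).exists_isMaxOn
    (f := fun z => (r / 2 - dist z a) * ‖deriv L z‖) ⟨a, mem_closedBall_self (by linarith)⟩
    ((by fun_prop : Continuous fun z => r / 2 - dist z a).continuousOn.mul
      ((hL.deriv isOpen_ball).continuousOn.mono hsub).norm)
  have hpa := mem_closedBall.1 hp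
  set R := (r / 2 - dist p a) / 2 with hR
  have hRp : r / 2 - dist p a = 2 * R := by rw [hR]; ring
  have hball : ball p R ⊆ closedBall a (r / 2) :=
    ball_subset_closedBall.trans (closedBall_subset_closedBall' (by linarith))
  have hderiv : ∀ z ∈ ball p R, ‖deriv L z‖ ≤ 2 * ‖deriv L p‖ := by
    intro z hz
    have hRpos := pos_of_mem_ball hz
    have hRz : R ≤ r / 2 - dist z a := by
      linarith [mem_ball.1 hz, dist_triangle z p a]
    refine le_of_mul_le_mul_left ?_ hRpos
    calc R * ‖deriv L z‖ ≤ (r / 2 - dist z a) * ‖deriv L z‖ := by gcongr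
      _ ≤ (r / 2 - dist p a) * ‖deriv L p‖ := hmax (hball hz)
      _ = R * (2 * ‖deriv L p‖) := by rw [hRp]; ring
  have hρ : ρ ≤ ‖deriv L p‖ * R / 24 := by
    have hmax_a : (r / 2 - dist a a) * ‖deriv L a‖ ≤ (r / 2 - dist p a) * ‖deriv L p‖ :=
      hmax (mem_closedBall_self (by linarith))
    rw [dist_self, sub_zero, hRp] at hmax_a
    linarith
  exact ⟨L p, (ball_subset_ball hρ).trans <|
    (ball_subset_image_ball_of_norm_deriv_le (hL.mono (hball.trans hsub)) hderiv).trans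
      (image_mono (hball.trans hsub))⟩

theorem exists_differentiableOn_log (hh : DifferentiableOn ℂ h (ball a r))
    (h0 : ∀ z ∈ ball a r, h z ≠ 0) :
    ∃ L : ℂ → ℂ, L a = 0 ∧ DifferentiableOn ℂ L (ball a r) ∧
      ∀ z ∈ ball a r, h z = h a * Complex.exp (L z) := by
  obtain ⟨L, hLa, hL⟩ :=
    ((hh.deriv isOpen_ball).div hh h0).isExactOn_ball.with_val_at a 0
  refine ⟨L, hLa, fun z hz => (hL z hz).differentiableAt.differentiableWithinAt, fun z hz => ?_⟩
  have hderiv : ∀ x ∈ ball a r,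
      HasDerivWithinAt (fun z => h z * Complex.exp (-L z)) 0 (ball a r) x := by
    intro x hx
    have hhx := (hh.differentiableAt (isOpen_ball.mem_nhds hx)).hasDerivAt
    refine (hhx.fun_mul (hL x hx).fun_neg.cexp).hasDerivWithinAt.congr_deriv ?_
    have hcancel : h x * (deriv h / h) x = deriv h x := mul_div_cancel₀ _ (h0 x hx)
    linear_combination (-Complex.exp (-L x)) * hcancel
  have hconst := (convex_ball a r).norm_image_sub_le_of_norm_hasDerivWithin_le
    (C := 0) hderiv (by simp) (mem_ball_self (pos_of_mem_ball hz)) hz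
  simp only [zero_mul, norm_le_zero_iff, sub_eq_zero, hLa, neg_zero, Complex.exp_zero,
    mul_one] at hconst
  rw [← hconst, mul_assoc, ← Complex.exp_add, neg_add_cancel, Complex.exp_zero, mul_one]

theorem not_ball_subset_image_of_injOn_exp (hinj : InjOn (fun z => Complex.exp (L z)) S) :
    ¬ ball p 4 ⊆ L '' S := by
  intro hp
  have hπ := Real.pi_lt_d2
  obtain ⟨x, hx, hLx⟩ := hp (show p + Real.pi * Complex.I ∈ ball p 4 by
    simp only [mem_ball, dist_self_add_left, norm_mul, Complex.norm_real, Real.norm_eq_abs,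
      abs_of_pos Real.pi_pos, Complex.norm_I]
    linarith)
  obtain ⟨y, hy, hLy⟩ := hp (show p - Real.pi * Complex.I ∈ ball p 4 by
    simp only [mem_ball, dist_self_sub_left, norm_mul, Complex.norm_real, Real.norm_eq_abs,
      abs_of_pos Real.pi_pos, Complex.norm_I]
    linarith)
  have hxy : L x = L y + 2 * Real.pi * Complex.I := by rw [hLx, hLy]; ring
  have heq : x = y := hinj hx hy (by simp only [hxy, Complex.exp_periodic (L y)])
  rw [heq] at hxy
  simp at hxy

theorem norm_deriv_le_of_injOn_exp (hr : 0 < r) (hL : DifferentiableOn ℂ L (ball a r))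
    (hinj : InjOn (fun z => Complex.exp (L z)) (ball a r)) : ‖deriv L a‖ ≤ 384 / r := by
  by_contra! hlt
  rw [div_lt_iff₀ hr] at hlt
  obtain ⟨p, hp⟩ := exists_ball_subset_image_of_lt_norm_deriv (ρ := 4) hr hL (by linarith)
  exact not_ball_subset_image_of_injOn_exp hinj hp

/-- As `h` omits `v`, there is a logarithm of `h - v`. Its image contains no disk of radius `4 > π`,
so its derivative is bounded by Bloch's theorem. -/
theorem norm_sub_le_of_injOn_of_omits (hh : DifferentiableOn ℂ h (ball a r))
    (hinj : InjOn h (ball a r)) (hv : ∀ z ∈ ball a r, h z ≠ v) (hz : z ∈ ball a (r / 2)) :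
    ‖h z - v‖ ≤ Real.exp 384 * ‖h a - v‖ := by
  have hr : 0 < r := by linarith [pos_of_mem_ball hz]
  obtain ⟨L, hLa, hL, hexp⟩ := exists_differentiableOn_log (hh.sub_const v)
    fun z hz => sub_ne_zero.2 (hv z hz)
  have hinj_exp : InjOn (fun z => Complex.exp (L z)) (ball a r) := by
    intro x hx y hy hxy
    refine hinj hx hy (sub_left_injective (b := v) ?_)
    simp only [hexp x hx, hexp y hy, hxy]
  have hsub : ball a (r / 2) ⊆ ball a r := ball_subset_ball (by linarith)
  have hderiv : ∀ w ∈ ball a (r / 2), ‖deriv L w‖ ≤ 384 / (r / 2) := by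
    intro w hw
    have hw_sub : ball w (r / 2) ⊆ ball a r :=
      ball_subset_ball' (by linarith [mem_ball.1 hw])
    exact norm_deriv_le_of_injOn_exp (half_pos hr) (hL.mono hw_sub) (hinj_exp.mono hw_sub)
  have hLz : ‖L z‖ ≤ 384 := by
    have hlip := (convex_ball a (r / 2)).norm_image_sub_le_of_norm_deriv_le
      (fun x hx => hL.differentiableAt (isOpen_ball.mem_nhds (hsub hx))) hderiv
      (mem_ball_self (half_pos hr)) hz
    rw [hLa, sub_zero] at hlip
    calc ‖L z‖ ≤ 384 / (r / 2) * ‖z - a‖ := hlip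
      _ ≤ 384 / (r / 2) * (r / 2) := by gcongr; exact (mem_ball_iff_norm.1 hz).le
      _ = 384 := div_mul_cancel₀ _ (half_pos hr).ne'
  rw [hexp z (hsub hz), norm_mul, mul_comm, Complex.norm_exp]
  gcongr
  exact (Complex.re_le_norm _).trans hLz

end Distortion

section Convergence

theorem exists_subseq_forall_tendsto {ι X : Type*} [Countable ι] [TopologicalSpace X]
    [FirstCountableTopology X] {u : ℕ → ι → X}
    (hu : ∀ i, ∃ K, IsCompact K ∧ ∀ᶠ n in atTop, u n i ∈ K) :
    ∃ φ : ℕ → ℕ, StrictMono φ ∧ ∀ i, ∃ b, Tendsto (fun n => u (φ n) i) atTop (𝓝 b) := by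
  classical
  choose K hK huK using hu
  choose k hk using fun i => (huK i).exists
  have hmem : ∀ n, (fun i => if u n i ∈ K i then u n i else u (k i) i) ∈ univ.pi K := by
    intro n i _
    dsimp only
    split_ifs with h
    exacts [h, hk i]
  obtain ⟨b, -, φ, hφ, hb⟩ := (isCompact_univ_pi hK).tendsto_subseq hmem
  refine ⟨φ, hφ, fun i => ⟨b i, (tendsto_pi_nhds.1 hb i).congr' ?_⟩⟩
  filter_upwards [hφ.tendsto_atTop.eventually (huK i)] with n hn
  exact if_pos hn

variable {ι X Y : Type*} [TopologicalSpace X] [PseudoMetricSpace Y] {l : Filter ι}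
  {F : ι → X → Y} {f : X → Y} {U D : Set X} {z : X}

theorem exists_tendsto_of_tendsto_dist [l.NeBot] [CompleteSpace Y]
    (hF : Tendsto (fun p : ι × X => dist (F p.1 p.2) (F p.1 z)) (l ×ˢ 𝓝 z) (𝓝 0))
    (hz : z ∈ closure D) (hD : ∀ y ∈ D, ∃ b, Tendsto (fun i => F i y) l (𝓝 b)) :
    ∃ b, Tendsto (fun i => F i z) l (𝓝 b) := by
  refine cauchy_map_iff_exists_tendsto.1 (Metric.cauchy_iff.2 ⟨inferInstance, fun ε hε => ?_⟩)
  obtain ⟨P, hP, Q, hQ, hPQ⟩ :=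
    eventually_prod_iff.1 (hF.eventually (gt_mem_nhds (by positivity : 0 < ε / 4)))
  obtain ⟨y, hyQ, hyD⟩ := mem_closure_iff_nhds.1 hz _ hQ
  obtain ⟨b, hb⟩ := hD y hyD
  refine ⟨ball b (ε / 2), mem_map.2 ?_, fun x hx x' hx' => ?_⟩
  · filter_upwards [hP, hb.eventually (ball_mem_nhds b (by positivity : 0 < ε / 4))] with i hi hi'
    have hzy := hPQ hi hyQ
    have htri := dist_triangle_left (F i z) b (F i y)
    exact mem_ball.2 (by linarith [mem_ball.1 hi'])
  · linarith [dist_triangle_right x x' b, mem_ball.1 hx, mem_ball.1 hx']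

theorem tendsto_prod_of_tendsto_dist
    (hF : Tendsto (fun p : ι × X => dist (F p.1 p.2) (F p.1 z)) (l ×ˢ 𝓝 z) (𝓝 0))
    (hf : Tendsto (fun i => F i z) l (𝓝 (f z))) :
    Tendsto (fun p : ι × X => F p.1 p.2) (l ×ˢ 𝓝 z) (𝓝 (f z)) := by
  have hz := (tendsto_iff_dist_tendsto_zero.1 hf).comp (tendsto_fst (g := 𝓝 z))
  refine tendsto_iff_dist_tendsto_zero.2 (squeeze_zero (fun _ => dist_nonneg)
    (fun p => dist_triangle _ (F p.1 z) _) ?_)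
  simpa only [add_zero, Function.comp_apply] using hF.add hz

theorem continuousAt_of_tendsto_prod [l.NeBot] (hU : U ∈ 𝓝 z)
    (hF : ∀ x ∈ U, Tendsto (fun p : ι × X => F p.1 p.2) (l ×ˢ 𝓝 x) (𝓝 (f x))) :
    ContinuousAt f z := by
  refine Metric.tendsto_nhds.2 fun ε hε => ?_
  obtain ⟨P, hP, Q, hQ, hPQ⟩ := eventually_prod_iff.1
    ((hF z (mem_of_mem_nhds hU)).eventually (ball_mem_nhds _ (half_pos hε)))
  filter_upwards [hU, hQ] with x hxU hxQ
  have hx : Tendsto (fun i => F i x) l (𝓝 (f x)) :=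
    (hF x hxU).comp (tendsto_id.prodMk tendsto_const_nhds)
  have hdist := le_of_tendsto (hx.dist tendsto_const_nhds)
    (hP.mono fun i hi => (mem_ball.1 (hPQ hi hxQ)).le)
  linarith

theorem tendstoLocallyUniformlyOn_of_tendsto_prod [l.NeBot] (hU : IsOpen U)
    (hF : ∀ x ∈ U, Tendsto (fun p : ι × X => F p.1 p.2) (l ×ˢ 𝓝 x) (𝓝 (f x))) :
    TendstoLocallyUniformlyOn F f l U := by
  refine hU.tendstoLocallyUniformlyOn_iff_forall_tendsto.2 fun x hx => ?_
  have hf := (continuousAt_of_tendsto_prod (hU.mem_nhds hx) hF).tendsto.comp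
    (tendsto_snd (f := l))
  refine Metric.uniformity_eq_comap_nhds_zero (α := Y) ▸ tendsto_comap_iff.2 ?_
  simpa only [dist_self, Function.comp_def] using hf.dist (hF x hx)

theorem tendsto_prod_of_tendstoLocallyUniformlyOn (hU : IsOpen U)
    (hF : TendstoLocallyUniformlyOn F f l U) (hf : ContinuousOn f U) (hz : z ∈ U) :
    Tendsto (fun p : ι × X => F p.1 p.2) (l ×ˢ 𝓝 z) (𝓝 (f z)) := by
  have hdist := hU.tendstoLocallyUniformlyOn_iff_forall_tendsto.1 hF z hz
  rw [Metric.uniformity_eq_comap_nhds_zero] at hdist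
  have hfz := ((hf.continuousAt (hU.mem_nhds hz)).tendsto.comp (tendsto_snd (f := l)))
  exact hfz.congr_dist (tendsto_comap_iff.1 hdist)

end Convergence

/-- The sets `W n` eventually contain each compact subset of `U`. This is how functions which are
only controlled on varying domains `W n` are made to converge on `U`. -/
def CompactlyExhausts {ι X : Type*} [TopologicalSpace X] (l : Filter ι) (W : ι → Set X)
    (U : Set X) : Prop :=
  ∀ K ⊆ U, IsCompact K → ∀ᶠ n in l, K ⊆ W n

namespace CompactlyExhausts

variable {ι ι' X : Type*} [TopologicalSpace X] {l : Filter ι} {W : ι → Set X} {U : Set X}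
  {z : X}

theorem comp (h : CompactlyExhausts l W U) {l' : Filter ι'} {φ : ι' → ι} (hφ : Tendsto φ l' l) :
    CompactlyExhausts l' (fun n => W (φ n)) U :=
  fun K hKU hK => hφ.eventually (h K hKU hK)

theorem eventually_mem (h : CompactlyExhausts l W U) (hz : z ∈ U) : ∀ᶠ n in l, z ∈ W n :=
  (h {z} (singleton_subset_iff.2 hz) isCompact_singleton).mono fun _ => singleton_subset_iff.1

theorem exists_mem_nhds [LocallyCompactSpace X] (h : CompactlyExhausts l W U) (hU : U ∈ 𝓝 z) :
    ∃ K ∈ 𝓝 z, IsCompact K ∧ K ⊆ U ∧ ∀ᶠ n in l, K ⊆ W n := by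
  obtain ⟨K, hK, hKU, hKc⟩ := local_compact_nhds hU
  exact ⟨K, hK, hKc, hKU, h K hKU hKc⟩

theorem of_forall_eventually (h : ∀ x ∈ U, ∀ᶠ p in l ×ˢ 𝓝 x, p.2 ∈ W p.1) :
    CompactlyExhausts l W U := by
  intro K hKU hK
  have hmem := hK.mem_prod_nhdsSet_of_forall (s := {p : ι × X | p.2 ∈ W p.1})
    fun x hx => h x (hKU hx)
  obtain ⟨t, ht, s, hs, hts⟩ := mem_prod_iff.1 hmem
  filter_upwards [ht] with n hn x hx
  exact hts (mk_mem_prod hn (subset_of_mem_nhdsSet hs hx))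

end CompactlyExhausts

section HolomorphicLimits

variable {ι : Type*} {l : Filter ι} {F : ι → ℂ → ℂ} {f : ℂ → ℂ} {W : ι → Set ℂ} {U V : Set ℂ}
  {z : ℂ}

theorem CompactlyExhausts.exists_differentiableOn (hW : CompactlyExhausts l W U)
    (hF : ∀ n, DifferentiableOn ℂ (F n) (W n)) (hU : IsOpen U) (hz : z ∈ U) :
    ∃ V, IsOpen V ∧ z ∈ V ∧ V ⊆ U ∧ ∀ᶠ n in l, DifferentiableOn ℂ (F n) V := by
  obtain ⟨K, hK, -, hKU, hKW⟩ := hW.exists_mem_nhds (hU.mem_nhds hz)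
  exact ⟨interior K, isOpen_interior, mem_interior_iff_mem_nhds.2 hK,
    interior_subset.trans hKU, hKW.mono fun n hn => (hF n).mono (interior_subset.trans hn)⟩

theorem differentiableOn_of_tendstoLocallyUniformlyOn [l.NeBot] (hU : IsOpen U)
    (hW : CompactlyExhausts l W U) (hF : ∀ n, DifferentiableOn ℂ (F n) (W n))
    (hFf : TendstoLocallyUniformlyOn F f l U) : DifferentiableOn ℂ f U := by
  intro z hz
  obtain ⟨V, hV, hzV, hVU, hFV⟩ := hW.exists_differentiableOn hF hU hz
  exact (((hFf.mono hVU).differentiableOn hFV hV).differentiableAt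
    (hV.mem_nhds hzV)).differentiableWithinAt

theorem tendsto_deriv_of_tendstoLocallyUniformlyOn (hU : IsOpen U)
    (hW : CompactlyExhausts l W U) (hF : ∀ n, DifferentiableOn ℂ (F n) (W n))
    (hFf : TendstoLocallyUniformlyOn F f l U) (hz : z ∈ U) :
    Tendsto (fun n => deriv (F n) z) l (𝓝 (deriv f z)) := by
  obtain ⟨V, hV, hzV, hVU, hFV⟩ := hW.exists_differentiableOn hF hU hz
  exact ((hFf.mono hVU).deriv hFV hV).tendsto_at hzV

theorem tendsto_dist_of_eventually_norm_le {M : ℝ} (hV : V ∈ 𝓝 z)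
    (hd : ∀ᶠ n in l, DifferentiableOn ℂ (F n) V) (hM : ∀ᶠ n in l, ∀ x ∈ V, ‖F n x‖ ≤ M) :
    Tendsto (fun p : ι × ℂ => dist (F p.1 p.2) (F p.1 z)) (l ×ˢ 𝓝 z) (𝓝 0) := by
  obtain ⟨r, hr, hrV⟩ := Metric.mem_nhds_iff.1 hV
  have hdist : Tendsto (fun p : ι × ℂ => 2 * M / r * dist p.2 z) (l ×ˢ 𝓝 z) (𝓝 0) := by
    have hz : Tendsto (fun p : ι × ℂ => dist p.2 z) (l ×ˢ 𝓝 z) (𝓝 0) :=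
      (tendsto_iff_dist_tendsto_zero.1 tendsto_id).comp tendsto_snd
    simpa only [mul_zero] using hz.const_mul (2 * M / r)
  refine squeeze_zero' (Eventually.of_forall fun _ => dist_nonneg) ?_ hdist
  filter_upwards [(hd.and hM).prod_mk (ball_mem_nhds z hr)] with p ⟨⟨hdp, hMp⟩, hpz⟩
  refine Complex.dist_le_div_mul_dist_of_mapsTo_ball (hdp.mono hrV) (fun w hw => ?_) hpz
  calc dist (F p.1 w) (F p.1 z) ≤ ‖F p.1 w‖ + ‖F p.1 z‖ := dist_le_norm_add_norm _ _
    _ ≤ 2 * M := by linarith [hMp w (hrV hw), hMp z (mem_of_mem_nhds hV)]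

theorem exists_subseq_tendstoLocallyUniformlyOn {F : ℕ → ℂ → ℂ} {W : ℕ → Set ℂ}
    (hU : IsOpen U) (hW : CompactlyExhausts atTop W U)
    (hF : ∀ n, DifferentiableOn ℂ (F n) (W n))
    (hM : ∀ z ∈ U, ∃ V ∈ 𝓝 z, ∃ M : ℝ, ∀ᶠ n in atTop, ∀ x ∈ V, ‖F n x‖ ≤ M) :
    ∃ φ : ℕ → ℕ, StrictMono φ ∧
      ∃ f, TendstoLocallyUniformlyOn (fun n => F (φ n)) f atTop U := by
  have hequi : ∀ z ∈ U, Tendsto (fun p : ℕ × ℂ => dist (F p.1 p.2) (F p.1 z))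
      (atTop ×ˢ 𝓝 z) (𝓝 0) := by
    intro z hz
    obtain ⟨V, hV, M, hM⟩ := hM z hz
    obtain ⟨V', hV', hzV', -, hFV'⟩ := hW.exists_differentiableOn hF hU hz
    exact tendsto_dist_of_eventually_norm_le (inter_mem hV (hV'.mem_nhds hzV'))
      (hFV'.mono fun n hn => hn.mono inter_subset_right)
      (hM.mono fun n hn x hx => hn x hx.1)
  obtain ⟨D, hDU, hDc, hUD⟩ :=
    (TopologicalSpace.IsSeparable.of_separableSpace U).exists_countable_dense_subset
  have := hDc.to_subtype
  obtain ⟨φ, hφ, hlim⟩ := exists_subseq_forall_tendsto (u := fun n (y : D) => F n y) fun y => by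
    obtain ⟨V, hV, M, hM⟩ := hM y (hDU y.2)
    exact ⟨closedBall 0 M, isCompact_closedBall 0 M,
      hM.mono fun n hn => mem_closedBall_zero_iff.2 (hn y (mem_of_mem_nhds hV))⟩
  have hequi_φ : ∀ z ∈ U, Tendsto (fun p : ℕ × ℂ => dist (F (φ p.1) p.2) (F (φ p.1) z))
      (atTop ×ˢ 𝓝 z) (𝓝 0) :=
    fun z hz => (hequi z hz).comp (hφ.tendsto_atTop.prodMap tendsto_id)
  have hlim_U : ∀ z ∈ U, ∃ b, Tendsto (fun n => F (φ n) z) atTop (𝓝 b) := fun z hz =>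
    exists_tendsto_of_tendsto_dist (F := fun n => F (φ n)) (hequi_φ z hz) (hUD hz)
      fun y hy => hlim ⟨y, hy⟩
  choose! f hf using hlim_U
  exact ⟨φ, hφ, f, tendstoLocallyUniformlyOn_of_tendsto_prod hU fun z hz =>
    tendsto_prod_of_tendsto_dist (F := fun n => F (φ n)) (hequi_φ z hz) (hf z hz)⟩

end HolomorphicLimits

section OpenMapping

variable {ι : Type*} {l : Filter ι} {F P : ι → ℂ → ℂ} {f g p : ℂ → ℂ} {W : ι → Set ℂ}
  {U V : Set ℂ} {a b z : ℂ} {r t ε : ℝ}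

theorem eventually_ne_of_injOn (hU : U ∈ 𝓝 z) (hinj : InjOn g U) : ∀ᶠ x in 𝓝[≠] z, g x ≠ g z := by
  filter_upwards [self_mem_nhdsWithin, nhdsWithin_le_nhds hU] with x hx hxU hxz
  exact hx (hinj hxU (mem_of_mem_nhds hU) hxz)

theorem eventually_ne_of_isPreconnected (hU : IsOpen U) (hUc : IsPreconnected U)
    (hf : DifferentiableOn ℂ f U) (ha : a ∈ U) (hb : b ∈ U) (hab : f a ≠ f b) (hz : z ∈ U) :
    ∀ᶠ x in 𝓝[≠] z, f x ≠ f z := by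
  have hf_an := hf.analyticOnNhd hU
  refine ((hf_an z hz).eventually_eq_or_eventually_ne analyticAt_const).resolve_left
    fun hconst => hab ?_
  have hEq := hf_an.eqOn_of_preconnected_of_eventuallyEq analyticOnNhd_const hUc hz hconst
  rw [hEq ha, hEq hb]

theorem ball_subset_image_closedBall_of_le_norm_sub (hg : DifferentiableOn ℂ g (ball z r))
    (ht : 0 < t) (htr : t < r) (hε : 0 < ε) (hsphere : ∀ x ∈ sphere z t, ε ≤ ‖g x - g z‖) :
    ball (g z) (ε / 2) ⊆ g '' closedBall z t := by
  have hsub : closedBall z t ⊆ ball z r := closedBall_subset_ball htr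
  have hdiff : DiffContOnCl ℂ g (ball z t) :=
    DifferentiableOn.diffContOnCl (hg.mono (closure_ball_subset_closedBall.trans hsub))
  obtain ⟨x, hx⟩ := NormedSpace.sphere_nonempty (x := z).2 ht.le
  have hxz : g x ≠ g z := by
    rw [← sub_ne_zero, ← norm_pos_iff]
    exact hε.trans_le (hsphere x hx)
  have hne := eventually_ne_of_isPreconnected isOpen_ball (convex_ball z r).isPreconnected hg
    (hsub (sphere_subset_closedBall hx)) (mem_ball_self (ht.trans htr)) hxz
    (mem_ball_self (ht.trans htr))
  exact hdiff.ball_subset_image_closedBall ht hsphere (hne.frequently.filter_mono inf_le_left)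

theorem eventually_mem_image_of_tendstoLocallyUniformlyOn [l.NeBot] (hU : IsOpen U)
    (hW : CompactlyExhausts l W U) (hF : ∀ n, DifferentiableOn ℂ (F n) (W n))
    (hFf : TendstoLocallyUniformlyOn F f l U) (hz : z ∈ U) (hne : ∀ᶠ x in 𝓝[≠] z, f x ≠ f z)
    (hV : V ∈ 𝓝 z) : ∀ᶠ q in l ×ˢ 𝓝 (f z), q.2 ∈ F q.1 '' V := by
  have hf := (differentiableOn_of_tendstoLocallyUniformlyOn hU hW hF hFf).continuousOn
  obtain ⟨V', hV', hzV', hV'U, hFV'⟩ := hW.exists_differentiableOn hF hU hz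
  obtain ⟨r, hr, hball⟩ := Metric.mem_nhds_iff.1
    (inter_mem (inter_mem hV (hV'.mem_nhds hzV')) (eventually_nhdsWithin_iff.1 hne))
  have hsub : closedBall z (r / 2) ⊆ ball z r := closedBall_subset_ball (by linarith)
  have hsubU : closedBall z (r / 2) ⊆ U := fun x hx => hV'U (hball (hsub hx)).1.2
  obtain ⟨w, hw, hmin⟩ := (isCompact_sphere z (r / 2)).exists_isMinOn
    (NormedSpace.sphere_nonempty.2 (by linarith)) (f := fun x => ‖f x - f z‖)
    ((hf.mono (sphere_subset_closedBall.trans hsubU)).sub continuousOn_const).norm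
  have hpos : 0 < ‖f w - f z‖ := norm_pos_iff.2 <| sub_ne_zero.2 <|
    (hball (hsub (sphere_subset_closedBall hw))).2 (ne_of_mem_sphere hw (by positivity))
  set m := ‖f w - f z‖
  have hunif := Metric.tendstoUniformlyOn_iff.1
    ((tendstoLocallyUniformlyOn_iff_tendstoUniformlyOn_of_compact
      (isCompact_closedBall z (r / 2))).1 (hFf.mono hsubU)) (m / 8) (by positivity)
  filter_upwards [(hunif.and hFV').prod_mk (ball_mem_nhds (f z) (by positivity : 0 < m / 8))]
    with ⟨n, y⟩ ⟨⟨hn, hFn⟩, hy⟩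
  have hnz := hn z (mem_closedBall_self (by linarith))
  have hsphere : ∀ x ∈ sphere z (r / 2), m / 2 ≤ ‖F n x - F n z‖ := by
    intro x hx
    have hmx : m ≤ dist (f x) (f z) := (hmin hx).trans_eq (dist_eq_norm _ _).symm
    have htri := dist_triangle4 (f x) (F n x) (F n z) (f z)
    rw [← dist_eq_norm]
    linarith [hn x (sphere_subset_closedBall hx), dist_comm (F n z) (f z)]
  have himage := ball_subset_image_closedBall_of_le_norm_sub
    (hFn.mono fun x hx => (hball hx).1.2) (half_pos hr) (half_lt_self hr)
    (half_pos hpos) hsphere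
  refine image_mono (fun x hx => (hball (hsub hx)).1.1) (himage (mem_ball.2 ?_))
  linarith [mem_ball.1 hy, dist_triangle y (f z) (F n z)]

theorem injOn_of_tendstoLocallyUniformlyOn [l.NeBot] (hU : IsOpen U) (hUc : IsPreconnected U)
    (hW : CompactlyExhausts l W U) (hF : ∀ n, DifferentiableOn ℂ (F n) (W n))
    (hinj : ∀ n, InjOn (F n) (W n)) (hFf : TendstoLocallyUniformlyOn F f l U) (ha : a ∈ U)
    (hb : b ∈ U) (hab : f a ≠ f b) : InjOn f U := by
  intro x hx y hy hxy
  by_contra hne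
  have hf := differentiableOn_of_tendstoLocallyUniformlyOn hU hW hF hFf
  obtain ⟨A, B, hA, hB, hxA, hyB, hAB⟩ := t2_separation hne
  have hhit : ∀ z ∈ U, ∀ V, IsOpen V → z ∈ V → ∀ᶠ n in l, f z ∈ F n '' (V ∩ W n) := by
    intro z hz V hV hzV
    obtain ⟨K, hK, -, -, hKW⟩ := hW.exists_mem_nhds (hU.mem_nhds hz)
    have himage := eventually_mem_image_of_tendstoLocallyUniformlyOn hU hW hF hFf hz
      (eventually_ne_of_isPreconnected hU hUc hf ha hb hab hz) (inter_mem (hV.mem_nhds hzV) hK)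
    filter_upwards [himage.curry, hKW] with n hn hKn
    exact image_mono (inter_subset_inter_right V hKn) hn.self_of_nhds
  obtain ⟨n, ⟨u, ⟨huA, hu⟩, huf⟩, v, ⟨hvB, hv⟩, hvf⟩ :=
    ((hhit x hx A hA hxA).and (hhit y hy B hB hyB)).exists
  have huv : u = v := hinj n hu hv (by rw [huf, hvf, hxy])
  exact hAB.notMem_of_mem_left huA (huv ▸ hvB)

theorem CompactlyExhausts.image [l.NeBot] (hU : IsOpen U) (hW : CompactlyExhausts l W U)
    (hF : ∀ n, DifferentiableOn ℂ (F n) (W n)) (hFf : TendstoLocallyUniformlyOn F f l U)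
    (hinj : InjOn f U) : CompactlyExhausts l (fun n => F n '' W n) (f '' U) := by
  refine of_forall_eventually ?_
  rintro _ ⟨z, hz, rfl⟩
  obtain ⟨K, hK, -, -, hKW⟩ := hW.exists_mem_nhds (hU.mem_nhds hz)
  filter_upwards [eventually_mem_image_of_tendstoLocallyUniformlyOn hU hW hF hFf hz
    (eventually_ne_of_injOn (hU.mem_nhds hz) hinj) hK, tendsto_fst.eventually hKW] with q hq hKq
  exact image_mono hKq hq

theorem tendsto_prod_leftInvOn [l.NeBot] (hU : IsOpen U) (hW : CompactlyExhausts l W U)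
    (hF : ∀ n, DifferentiableOn ℂ (F n) (W n)) (hFf : TendstoLocallyUniformlyOn F f l U)
    (hP : ∀ n, LeftInvOn (P n) (F n) (W n)) (hinj : InjOn f U) (hz : z ∈ U) :
    Tendsto (fun q : ι × ℂ => P q.1 q.2) (l ×ˢ 𝓝 (f z)) (𝓝 z) := by
  intro V hV
  rw [mem_map]
  obtain ⟨K, hK, -, -, hKW⟩ := hW.exists_mem_nhds (hU.mem_nhds hz)
  filter_upwards [eventually_mem_image_of_tendstoLocallyUniformlyOn hU hW hF hFf hz
    (eventually_ne_of_injOn (hU.mem_nhds hz) hinj) (inter_mem hV hK),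
    tendsto_fst.eventually hKW] with ⟨n, y⟩ ⟨x, hx, hxy⟩ hKn
  rw [mem_preimage, ← hxy, hP n (hKn hx.2)]
  exact hx.1

theorem nhds_le_map_nhds_of_injOn (hU : U ∈ 𝓝 z) (hg : DifferentiableOn ℂ g U)
    (hinj : InjOn g U) : 𝓝 (g z) ≤ map g (𝓝 z) := by
  refine (hg.analyticAt hU).eventually_constant_or_nhds_le_map_nhds.resolve_left fun hconst => ?_
  obtain ⟨x, hx, hx'⟩ := ((eventually_ne_of_injOn hU hinj).and
    (nhdsWithin_le_nhds hconst)).exists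
  exact hx hx'

theorem isOpen_image_of_injOn (hU : IsOpen U) (hg : DifferentiableOn ℂ g U) (hinj : InjOn g U) :
    IsOpen (g '' U) := by
  rw [isOpen_iff_mem_nhds]
  rintro _ ⟨z, hz, rfl⟩
  exact nhds_le_map_nhds_of_injOn (hU.mem_nhds hz) hg hinj (image_mem_map (hU.mem_nhds hz))

theorem tendstoLocallyUniformlyOn_leftInvOn [l.NeBot] (hU : IsOpen U)
    (hW : CompactlyExhausts l W U) (hF : ∀ n, DifferentiableOn ℂ (F n) (W n))
    (hFf : TendstoLocallyUniformlyOn F f l U) (hP : ∀ n, LeftInvOn (P n) (F n) (W n))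
    (hp : LeftInvOn p f U) : TendstoLocallyUniformlyOn P p l (f '' U) := by
  have hf := differentiableOn_of_tendstoLocallyUniformlyOn hU hW hF hFf
  refine tendstoLocallyUniformlyOn_of_tendsto_prod (isOpen_image_of_injOn hU hf hp.injOn) ?_
  rintro _ ⟨z, hz, rfl⟩
  rw [hp hz]
  exact tendsto_prod_leftInvOn hU hW hF hFf hP hp.injOn hz

end OpenMapping

section LocalRoot

variable {f g : ℂ → ℂ} {c z₀ : ℂ} {m : ℕ}

theorem exists_analyticAt_pow_eq (hg : AnalyticAt ℂ g z₀) (hg0 : g z₀ ≠ 0) (hm : m ≠ 0) :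
    ∃ k : ℂ → ℂ, AnalyticAt ℂ k z₀ ∧ k z₀ ≠ 0 ∧ ∀ᶠ z in 𝓝 z₀, k z ^ m = g z := by
  obtain ⟨α, hα⟩ := IsAlgClosed.exists_pow_nat_eq (g z₀) (Nat.pos_of_ne_zero hm)
  have hmc : (m : ℂ) ≠ 0 := Nat.cast_ne_zero.2 hm
  have hα0 : α ≠ 0 := by
    rintro rfl
    exact hg0 (hα ▸ zero_pow hm)
  have hlog : AnalyticAt ℂ (fun z => Complex.log (g z / g z₀)) z₀ :=
    (hg.div analyticAt_const hg0).clog (by simp [hg0])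
  refine ⟨fun z => α * Complex.exp (Complex.log (g z / g z₀) / m),
    analyticAt_const.mul (hlog.div analyticAt_const hmc).cexp,
    mul_ne_zero hα0 (Complex.exp_ne_zero _), ?_⟩
  filter_upwards [hg.continuousAt.eventually_ne hg0] with z hz
  rw [mul_pow, hα, ← Complex.exp_nat_mul, mul_div_cancel₀ _ hmc,
    Complex.exp_log (div_ne_zero hz hg0), mul_div_cancel₀ _ hg0]

theorem exists_analyticAt_eq_pow_add (hf : AnalyticAt ℂ f z₀) (hm : m ≠ 0)
    (horder : analyticOrderAt (fun z => f z - c) z₀ = m) :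
    ∃ h : ℂ → ℂ, AnalyticAt ℂ h z₀ ∧ h z₀ = 0 ∧ deriv h z₀ ≠ 0 ∧
      ∀ᶠ z in 𝓝 z₀, f z = h z ^ m + c := by
  obtain ⟨g, hg, hg0, hfg⟩ :=
    (hf.sub analyticAt_const : AnalyticAt ℂ (fun z => f z - c) z₀).analyticOrderAt_eq_natCast.1
      horder
  obtain ⟨k, hk, hk0, hkg⟩ := exists_analyticAt_pow_eq hg hg0 hm
  have hid : HasDerivAt (fun z => z - z₀) 1 z₀ := (hasDerivAt_id z₀).sub_const z₀
  have hderiv := hid.fun_mul hk.differentiableAt.hasDerivAt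
  refine ⟨fun z => (z - z₀) * k z, (analyticAt_id.sub analyticAt_const).mul hk, by simp, ?_, ?_⟩
  · simpa [hderiv.deriv] using hk0
  · filter_upwards [hfg, hkg] with z hfz hkz
    rw [mul_pow, hkz, ← smul_eq_mul, ← hfz, Pi.sub_apply, sub_add_cancel]

theorem exists_local_root (hf : AnalyticAt ℂ f z₀) (hm : m ≠ 0)
    (horder : analyticOrderAt (fun z => f z - c) z₀ = m) :
    ∃ ψ : ℂ → ℂ, AnalyticAt ℂ ψ 0 ∧ ψ 0 = z₀ ∧ deriv ψ 0 ≠ 0 ∧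
      ∀ᶠ ζ in 𝓝 0, f (ψ ζ) = ζ ^ m + c := by
  obtain ⟨h, hh, hh0, hh', hfh⟩ := exists_analyticAt_eq_pow_add hf hm horder
  set ψ := hh.hasStrictDerivAt.localInverse _ _ _ hh'
  have hψ_strict := hh.hasStrictDerivAt.to_localInverse hh'
  have hψ := hh.analyticAt_localInverse hh'
  have hright := hh.hasStrictDerivAt.eventually_right_inverse hh'
  have hψ0 : ψ 0 = z₀ := by
    have hleft := (hh.hasStrictDerivAt.eventually_left_inverse hh').self_of_nhds
    rwa [hh0] at hleft
  rw [hh0] at hψ_strict hψ hright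
  refine ⟨ψ, hψ, hψ0, ?_, ?_⟩
  · rw [hψ_strict.hasDerivAt.deriv]
    exact inv_ne_zero hh'
  · have hψ_cont : Tendsto ψ (𝓝 0) (𝓝 z₀) := hψ0 ▸ hψ.continuousAt.tendsto
    filter_upwards [hright, hψ_cont.eventually hfh] with ζ hζ hfζ
    rw [hfζ, hζ]

end LocalRoot

section UnivalentInverse

variable {f P : ℂ → ℂ} {U : Set ℂ} {z : ℂ}

theorem deriv_eq_zero_of_comp_mul_left {ψ : ℂ → ℂ} {ω : ℂ} (hψ : DifferentiableAt ℂ ψ 0)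
    (hω : ω ≠ 1) (hinv : (fun ζ => ψ (ω * ζ)) =ᶠ[𝓝 0] ψ) : deriv ψ 0 = 0 := by
  have hcomp : HasDerivAt (fun ζ => ψ (ω * ζ)) (deriv ψ 0 * ω) 0 := by
    refine HasDerivAt.comp 0 ?_ (hasDerivAt_const_mul ω)
    rw [mul_zero]
    exact hψ.hasDerivAt
  by_contra hψ'
  exact hω (mul_left_cancel₀ hψ' (by rw [← hcomp.deriv, hinv.deriv_eq, mul_one]))

theorem analyticOrderAt_sub_ne_top_of_injOn (hU : U ∈ 𝓝 z) (hinj : InjOn f U) :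
    analyticOrderAt (fun x => f x - f z) z ≠ ⊤ := by
  intro htop
  obtain ⟨x, hx, hx'⟩ := ((eventually_ne_of_injOn hU hinj).and
    (nhdsWithin_le_nhds (analyticOrderAt_eq_top.1 htop))).exists
  exact hx (sub_eq_zero.1 hx')

/-- Where the derivative vanishes, `f` is a power `ζ ^ m + c` with `m ≥ 2` in a suitable coordinate,
hence invariant under a nontrivial rotation. -/
theorem deriv_ne_zero_of_injOn (hU : U ∈ 𝓝 z) (hf : DifferentiableOn ℂ f U) (hinj : InjOn f U) :
    deriv f z ≠ 0 := by
  intro hderiv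
  have hfz : AnalyticAt ℂ f z := hf.analyticAt hU
  have horder := hfz.analyticOrderAt_deriv_add_one
  have hderiv_order : 1 ≤ analyticOrderAt (deriv f) z :=
    Order.one_le_iff_ne_zero.2 (hfz.deriv.analyticOrderAt_ne_zero.2 hderiv)
  obtain ⟨m, hm⟩ := ENat.ne_top_iff_exists.1 (analyticOrderAt_sub_ne_top_of_injOn hU hinj)
  have hm2 : 2 ≤ m := by
    have : (1 : ℕ∞) + 1 ≤ m := by
      rw [hm, ← horder]
      gcongr
    exact_mod_cast this
  obtain ⟨ψ, hψ, hψ0, hψ', hfψ⟩ := exists_local_root hfz (by lia) hm.symm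
  have hω := Complex.isPrimitiveRoot_exp m (by lia)
  set ω := Complex.exp (2 * Real.pi * Complex.I / m)
  have hrot : Tendsto (fun ζ : ℂ => ω * ζ) (𝓝 0) (𝓝 0) := by
    simpa using (continuous_const_mul ω).tendsto 0
  have hψU : ∀ᶠ ζ in 𝓝 0, ψ ζ ∈ U := hψ.continuousAt (hψ0 ▸ hU)
  refine hψ' (deriv_eq_zero_of_comp_mul_left hψ.differentiableAt (hω.ne_one (by lia)) ?_)
  filter_upwards [hψU, hrot.eventually hψU, hfψ, hrot.eventually hfψ] with ζ hζ hωζ hfζ hfωζ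
  exact hinj hωζ hζ (by rw [hfζ, hfωζ, mul_pow, hω.pow_eq_one, one_mul])

theorem continuousAt_leftInvOn (hU : U ∈ 𝓝 z) (hf : DifferentiableOn ℂ f U)
    (hP : LeftInvOn P f U) : ContinuousAt P (f z) := by
  rw [ContinuousAt, hP (mem_of_mem_nhds hU)]
  refine (tendsto_map'_iff.2 ?_ : Tendsto P (map f (𝓝 z)) (𝓝 z)).mono_left
    (nhds_le_map_nhds_of_injOn hU hf hP.injOn)
  exact tendsto_id.congr' (mem_of_superset hU fun x hx => (hP hx).symm)

theorem hasDerivAt_leftInvOn (hU : U ∈ 𝓝 z) (hf : DifferentiableOn ℂ f U) (hP : LeftInvOn P f U) :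
    HasDerivAt P (deriv f z)⁻¹ (f z) := by
  refine HasDerivAt.of_local_left_inverse (f := f) (continuousAt_leftInvOn hU hf hP) ?_
    (deriv_ne_zero_of_injOn hU hf hP.injOn) ?_
  · rw [hP (mem_of_mem_nhds hU)]
    exact (hf.differentiableAt hU).hasDerivAt
  · refine nhds_le_map_nhds_of_injOn hU hf hP.injOn (mem_map.2 ?_)
    exact mem_of_superset hU fun x hx => congr_arg f (hP hx)

theorem differentiableOn_leftInvOn (hU : IsOpen U) (hf : DifferentiableOn ℂ f U)
    (hP : LeftInvOn P f U) : DifferentiableOn ℂ P (f '' U) := by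
  rintro _ ⟨z, hz, rfl⟩
  exact (hasDerivAt_leftInvOn (hU.mem_nhds hz) hf hP).differentiableAt.differentiableWithinAt

end UnivalentInverse

section SlitPlane

theorem mem_slitPlane {J : Set ℝ} {z : ℂ} : z ∈ slitPlane J ↔ z.im ≠ 0 ∨ z.re ∈ J := by
  refine or_congr_right' fun hz => ⟨?_, fun h => ⟨z.re, h, ?_⟩⟩
  · rintro ⟨x, hx, rfl⟩
    exact hx
  · exact Complex.ext rfl (not_not.1 hz).symm

theorem ofReal_mem_slitPlane {J : Set ℝ} {x : ℝ} : (x : ℂ) ∈ slitPlane J ↔ x ∈ J := by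
  simp [mem_slitPlane]

theorem isOpen_slitPlane {J : Set ℝ} (hJ : IsOpen J) : IsOpen (slitPlane J) := by
  have hunion : slitPlane J = Complex.im ⁻¹' {0}ᶜ ∪ Complex.re ⁻¹' J :=
    ext fun _ => mem_slitPlane
  rw [hunion]
  exact (isOpen_compl_singleton.preimage Complex.continuous_im).union
    (hJ.preimage Complex.continuous_re)

theorem starConvex_slitPlane {J : Set ℝ} (hJ : J.OrdConnected) {c : ℝ} (hc : c ∈ J) :
    StarConvex ℝ (c : ℂ) (slitPlane J) := by
  intro z hz a b ha hb hab
  rw [mem_slitPlane] at hz ⊢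
  rcases hb.eq_or_lt with rfl | hb
  · right
    simpa [show a = 1 by linarith] using hc
  · refine hz.imp (fun him => ?_) fun hre => ?_
    · simpa using ⟨hb.ne', him⟩
    · simpa using hJ.convex hc hre ha hb.le hab

end SlitPlane

section RootDomain

variable {d : ℕ} {V : Set ℂ} {c : ℂ}

/-- The preimage of `V` under `ζ ↦ ζ ^ d + c`, on which the uniformization of a branched covering
of `V` with the single critical value `c` is defined. -/
def rootDomain (d : ℕ) (V : Set ℂ) (c : ℂ) : Set ℂ :=
  {ζ | ζ ^ d + c ∈ V}

theorem mem_rootDomain {ζ : ℂ} : ζ ∈ rootDomain d V c ↔ ζ ^ d + c ∈ V :=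
  Iff.rfl

theorem isOpen_rootDomain (hV : IsOpen V) : IsOpen (rootDomain d V c) :=
  hV.preimage (by fun_prop)

theorem zero_mem_rootDomain (hd : d ≠ 0) (hc : c ∈ V) : 0 ∈ rootDomain d V c := by
  simpa [mem_rootDomain, hd] using hc

theorem starConvex_rootDomain (hV : StarConvex ℝ c V) : StarConvex ℝ 0 (rootDomain d V c) := by
  rw [starConvex_zero_iff]
  intro ζ hζ t ht₀ ht₁
  have hmem := hV.add_smul_sub_mem hζ (pow_nonneg ht₀ d) (pow_le_one₀ ht₀ ht₁)
  simpa [mem_rootDomain, mul_pow, add_comm] using hmem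

theorem isPreconnected_rootDomain (hd : d ≠ 0) (hc : c ∈ V) (hV : StarConvex ℝ c V) :
    IsPreconnected (rootDomain d V c) :=
  ((starConvex_rootDomain hV).isPathConnected
    (zero_mem_rootDomain hd hc)).isConnected.isPreconnected

end RootDomain

section Covering

variable {f : ℂ → ℂ} {G V : Set ℂ} {c : ℂ}

theorem isLocalHomeomorphOn_of_deriv_ne_zero {s : Set ℂ} (hf : ∀ z ∈ s, AnalyticAt ℂ f z)
    (hf' : ∀ z ∈ s, deriv f z ≠ 0) : IsLocalHomeomorphOn f s := fun z hz =>
  let hstrict := (hf z hz).hasStrictDerivAt.hasStrictFDerivAt_equiv (hf' z hz)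
  ⟨hstrict.toOpenPartialHomeomorph f, hstrict.mem_toOpenPartialHomeomorph_source, rfl⟩

theorem isLocalHomeomorph_restrict {s t : Set ℂ} (hs : IsOpen s) (ht : IsOpen t)
    (hf : DifferentiableOn ℂ f s) (hf' : ∀ z ∈ s, deriv f z ≠ 0) (hst : MapsTo f s t) :
    IsLocalHomeomorph (hst.restrict f s t) := by
  have hfs : IsLocalHomeomorphOn f s :=
    isLocalHomeomorphOn_of_deriv_ne_zero (fun z hz => hf.analyticAt (hs.mem_nhds hz)) hf'
  refine IsLocalHomeomorph.of_comp (g := Subtype.val) ?_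
    ht.isOpenEmbedding_subtypeVal.isLocalHomeomorph (hf.continuousOn.mapsToRestrict hst)
  exact isLocalHomeomorph_iff_isLocalHomeomorphOn_univ.2
    (hfs.comp hs.isOpenEmbedding_subtypeVal.isLocalHomeomorph.isLocalHomeomorphOn fun z _ => z.2)

theorem isProperMap_restrict {s t : Set ℂ} (ht : IsOpen t) (hf : ContinuousOn f s)
    (hst : MapsTo f s t) (hproper : ∀ L ⊆ t, IsCompact L → IsCompact (s ∩ f ⁻¹' L)) :
    IsProperMap (hst.restrict f s t) := by
  have : LocallyCompactSpace t := ht.locallyCompactSpace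
  refine isProperMap_iff_isCompact_preimage.2 ⟨hf.mapsToRestrict hst, fun K hK => ?_⟩
  rw [Subtype.isCompact_iff]
  convert hproper _ (Subtype.coe_image_subset t K) (hK.image continuous_subtype_val) using 1
  ext z
  constructor
  · rintro ⟨w, hw, rfl⟩
    exact ⟨w.2, _, hw, rfl⟩
  · rintro ⟨hz, w, hw, hwz⟩
    have hw_eq : hst.restrict f s t ⟨z, hz⟩ = w := Subtype.ext hwz.symm
    exact ⟨⟨z, hz⟩, mem_preimage.2 (hw_eq ▸ hw), rfl⟩

theorem isCoveringMap_of_isProperMap {E X : Type*} [TopologicalSpace E] [TopologicalSpace X]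
    [T2Space E] {p : E → X} (hp : IsProperMap p) (hloc : IsLocalHomeomorph p) :
    IsCoveringMap p := by
  refine isCoveringMap_iff_isCoveringMapOn_univ.2
    (hp.isClosedMap.isCoveringMapOn_of_isLocalHomeomorphOn (fun x _ => ?_)
      (hloc.isLocalHomeomorphOn.mono (subset_univ _)))
  refine (hp.isCompact_preimage isCompact_singleton).finite
    (IsDiscrete.of_openPartialHomeomorph p subset_rfl fun e _ => ?_)
  obtain ⟨φ, hφ, hφp⟩ := hloc e
  exact ⟨φ, hφ, hφp.symm⟩

theorem exists_lift_of_deformation {E X A : Type*} [TopologicalSpace E] [TopologicalSpace X]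
    [TopologicalSpace A] {p : E → X} (hp : IsCoveringMap p) {U : Set A}
    (ρ : C(unitInterval × A, A)) (hρ₀ : ∀ a, ρ (0, a) ∈ U) (hρ₁ : ∀ a, ρ (1, a) = a)
    (hρU : ∀ t, ∀ a ∈ U, ρ (t, a) ∈ U) (q : C(A, X)) (s₀ : C(U, E))
    (hs₀ : ∀ u : U, p (s₀ u) = q u) :
    ∃ s : C(A, E), (∀ a, p (s a) = q a) ∧ ∀ u : U, s u = s₀ u := by
  let start : C(A, E) := s₀.comp ⟨fun a => ⟨ρ (0, a), hρ₀ a⟩, by fun_prop⟩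
  have hstart : ∀ a, (q.comp ρ) (0, a) = p (start a) := fun a => (hs₀ ⟨_, hρ₀ a⟩).symm
  let lift := hp.liftHomotopy (q.comp ρ) start hstart
  have hlift : ∀ t a, p (lift (t, a)) = q (ρ (t, a)) := fun t a =>
    congrFun (hp.liftHomotopy_lifts _ start hstart) (t, a)
  refine ⟨⟨fun a => lift (1, a), by fun_prop⟩, fun a => (hlift 1 a).trans (by rw [hρ₁]),
    fun u => ?_⟩
  let local_lift : unitInterval → E := fun t => s₀ ⟨ρ (t, u), hρU t u u.2⟩
  have heq : (fun t => lift (t, (u : A))) = local_lift := by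
    refine hp.eq_of_comp_eq (by fun_prop) (s₀.continuous.comp (by fun_prop)) ?_ 0
      (hp.liftHomotopy_zero _ start hstart u)
    exact funext fun t => (hlift t u).trans (hs₀ ⟨_, hρU t u u.2⟩).symm
  exact (congrFun heq 1).trans (congrArg s₀ (Subtype.ext (hρ₁ u)))

theorem exists_deformation_into_ball {F : Type*} [NormedAddCommGroup F] [NormedSpace ℝ F]
    {A : Set F} (hA : ∀ a ∈ A, ∀ t : ℝ, 0 < t → t ≤ 1 → t • a ∈ A) {ε : ℝ} (hε : 0 < ε) :
    ∃ ρ : C(unitInterval × A, A), (∀ a, ‖(ρ (0, a) : F)‖ < ε) ∧ (∀ a, ρ (1, a) = a) ∧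
      ∀ t a, ‖(ρ (t, a) : F)‖ ≤ ‖(a : F)‖ := by
  let scale : unitInterval × A → ℝ := fun q => ((q.1 : ℝ) * ‖(q.2 : F)‖ + ε) / (‖(q.2 : F)‖ + ε)
  have hscale : Continuous scale :=
    Continuous.div (by fun_prop) (by fun_prop) fun q => by positivity
  have hpos : ∀ q, 0 < scale q := fun q =>
    div_pos (add_pos_of_nonneg_of_pos (mul_nonneg q.1.2.1 (norm_nonneg _)) hε) (by positivity)
  have hle : ∀ q, scale q ≤ 1 := fun q => by
    refine div_le_one_of_le₀ ?_ (by positivity)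
    gcongr
    exact mul_le_of_le_one_left (norm_nonneg _) q.1.2.2
  have hnorm : ∀ q, ‖scale q • (q.2 : F)‖ = scale q * ‖(q.2 : F)‖ := fun q => by
    rw [norm_smul, Real.norm_of_nonneg (hpos q).le]
  refine ⟨⟨fun q => ⟨scale q • (q.2 : F), hA _ q.2.2 _ (hpos q) (hle q)⟩, ?_⟩, ?_, ?_, ?_⟩
  · exact (hscale.smul (by fun_prop)).subtype_mk _
  · intro a
    refine (hnorm (0, a)).trans_lt ?_
    simp only [scale, Icc.coe_zero, zero_mul, zero_add]
    rw [div_mul_eq_mul_div, div_lt_iff₀ (by positivity)]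
    nlinarith [norm_nonneg (a : F)]
  · intro a
    have hne : ‖(a : F)‖ + ε ≠ 0 := by positivity
    exact Subtype.ext (by simp [scale, div_self hne])
  · intro t a
    exact (hnorm (t, a)).trans_le (mul_le_of_le_one_left (norm_nonneg _) (hle _))

theorem isCoveringMap_restrict (hV : IsOpen V) (hG : IsOpen G) (hf : DifferentiableOn ℂ f G)
    (hproper : ∀ L ⊆ V, IsCompact L → IsCompact (G ∩ f ⁻¹' L))
    (hf' : ∀ z ∈ G, f z ≠ c → deriv f z ≠ 0)
    (hmaps : MapsTo f (G ∩ f ⁻¹' (V \ {c})) (V \ {c})) :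
    IsCoveringMap (hmaps.restrict f (G ∩ f ⁻¹' (V \ {c})) (V \ {c})) := by
  have hVc : IsOpen (V \ {c}) := hV.sdiff isClosed_singleton
  refine isCoveringMap_of_isProperMap (isProperMap_restrict hVc
    (hf.continuousOn.mono inter_subset_left) hmaps fun L hL hLc => ?_)
    (isLocalHomeomorph_restrict (hf.continuousOn.isOpen_inter_preimage hG hVc) hVc
      (hf.mono inter_subset_left) (fun z hz => hf' z hz.1 hz.2.2) hmaps)
  rw [inter_assoc, ← preimage_inter, inter_eq_right.2 hL]
  exact hproper L (hL.trans sdiff_subset) hLc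

theorem exists_root_section_extension (hV : IsOpen V) (hVc : StarConvex ℝ c V) (hG : IsOpen G)
    (hf : DifferentiableOn ℂ f G)
    (hproper : ∀ L ⊆ V, IsCompact L → IsCompact (G ∩ f ⁻¹' L))
    (hf' : ∀ z ∈ G, f z ≠ c → deriv f z ≠ 0) {m : ℕ} {ε : ℝ} (hε : 0 < ε)
    {ψ₀ : ℂ → ℂ} (hψ₀ : ContinuousOn ψ₀ (ball 0 ε)) (hψ₀G : MapsTo ψ₀ (ball 0 ε) G)
    (hfψ₀ : ∀ ζ ∈ ball 0 ε, f (ψ₀ ζ) = ζ ^ m + c) :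
    ∃ ψ : ℂ → ℂ, ContinuousOn ψ (rootDomain m V c \ {0}) ∧ MapsTo ψ (rootDomain m V c \ {0}) G ∧
      (∀ ζ ∈ rootDomain m V c \ {0}, f (ψ ζ) = ζ ^ m + c) ∧
      EqOn ψ ψ₀ (rootDomain m V c ∩ ball 0 ε) := by
  set A := rootDomain m V c \ {0}
  set E := G ∩ f ⁻¹' (V \ {c})
  have hpow : ∀ ζ ∈ A, ζ ^ m + c ∈ V \ {c} := fun ζ hζ =>
    ⟨hζ.1, fun h => pow_ne_zero m hζ.2 (by simpa using h)⟩
  have hcov := isCoveringMap_restrict hV hG hf hproper hf' fun _ hz => hz.2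
  obtain ⟨ρ, hρ₀, hρ₁, hρ⟩ := exists_deformation_into_ball (A := A) (fun a ha t ht₀ ht₁ =>
    ⟨(starConvex_rootDomain hVc).smul_mem ha.1 ht₀.le ht₁, smul_ne_zero ht₀.ne' ha.2⟩) hε
  let q : C(A, (V \ {c} : Set ℂ)) := ⟨fun a => ⟨(a : ℂ) ^ m + c, hpow a a.2⟩, by fun_prop⟩
  let s₀ : C({a : A | ‖(a : ℂ)‖ < ε}, E) :=
    ⟨fun a => ⟨ψ₀ a, hψ₀G (mem_ball_zero_iff.2 a.2), by
      rw [mem_preimage, hfψ₀ _ (mem_ball_zero_iff.2 a.2)]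
      exact hpow _ a.1.2⟩,
    (hψ₀.comp_continuous (by fun_prop) fun a => mem_ball_zero_iff.2 a.2).subtype_mk _⟩
  obtain ⟨s, hs, hss₀⟩ := exists_lift_of_deformation hcov ρ hρ₀ hρ₁
    (fun t a ha => (hρ t a).trans_lt ha) q s₀
    fun u => Subtype.ext (hfψ₀ _ (mem_ball_zero_iff.2 u.2))
  classical
  let ψ : ℂ → ℂ := fun ζ => if h : ζ ∈ A then s ⟨ζ, h⟩ else ψ₀ ζ
  have hψ : ∀ a : A, ψ a = s a := fun a => dif_pos a.2
  refine ⟨ψ, ?_, fun ζ hζ => ?_, fun ζ hζ => ?_, fun ζ hζ => ?_⟩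
  · refine continuousOn_iff_continuous_domRestrict.2 ?_
    exact (continuous_subtype_val.comp s.continuous).congr fun a => (hψ a).symm
  · exact (hψ ⟨ζ, hζ⟩).symm ▸ (s ⟨ζ, hζ⟩).2.1
  · exact (congrArg f (hψ ⟨ζ, hζ⟩)).trans (congrArg Subtype.val (hs ⟨ζ, hζ⟩))
  · by_cases hζA : ζ ∈ A
    · exact (hψ ⟨ζ, hζA⟩).trans
        (congrArg Subtype.val (hss₀ ⟨⟨ζ, hζA⟩, mem_ball_zero_iff.1 hζ.2⟩))
    · exact dif_neg hζA

theorem differentiableAt_of_comp_eq {ψ q : ℂ → ℂ} {ζ : ℂ} (hψ : ContinuousAt ψ ζ)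
    (hf : AnalyticAt ℂ f (ψ ζ)) (hf' : deriv f (ψ ζ) ≠ 0) (hq : DifferentiableAt ℂ q ζ)
    (h : ∀ᶠ x in 𝓝 ζ, f (ψ x) = q x) : DifferentiableAt ℂ ψ ζ := by
  have hstrict := hf.hasStrictDerivAt
  have hinv := (hstrict.to_localInverse hf').hasDerivAt.differentiableAt
  have hleft := (hstrict.hasStrictFDerivAt_equiv hf').eventually_left_inverse
  rw [h.self_of_nhds] at hinv
  refine (hinv.comp ζ hq).congr_of_eventuallyEq ?_
  filter_upwards [h, hψ.eventually hleft] with x hx hxleft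
  rw [Function.comp_apply, ← hx]
  exact hxleft.symm

end Covering

section Uniformization

/-- `ψ` is a univalent parametrization of `G` by `rootDomain d V c` that turns `f : G → V` into
`ζ ↦ ζ ^ d + c`: a uniformization of a `d`-fold covering branched only over `c`. -/
structure IsUniformization (d : ℕ) (f : ℂ → ℂ) (G V : Set ℂ) (c : ℂ) (ψ : ℂ → ℂ) : Prop where
  differentiableOn : DifferentiableOn ℂ ψ (rootDomain d V c)
  injOn : InjOn ψ (rootDomain d V c)
  image_eq : ψ '' rootDomain d V c = G
  map_comp : ∀ ζ ∈ rootDomain d V c, f (ψ ζ) = ζ ^ d + c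

variable {f : ℂ → ℂ} {G V : Set ℂ} {b c : ℂ} {d m : ℕ}

theorem analyticOrderAt_sub_ne_top_of_deriv_ne_zero (hf : ∀ᶠ z in 𝓝[≠] b, deriv f z ≠ 0) :
    analyticOrderAt (fun z => f z - c) b ≠ ⊤ := by
  rw [Ne, analyticOrderAt_eq_top]
  intro hconst
  have hfalse : ∀ᶠ _ in 𝓝[≠] b, False := by
    filter_upwards [hf, hconst.eventually_nhds.filter_mono nhdsWithin_le_nhds] with z hz hzc
    have heq : f =ᶠ[𝓝 z] fun _ => c := hzc.mono fun _ hx => sub_eq_zero.1 hx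
    exact hz (heq.deriv_eq.trans (deriv_const z c))
  exact hfalse.exists.elim fun _ h => h

theorem exists_differentiableOn_root_section (hV : IsOpen V) (hVc : StarConvex ℝ c V)
    (hc : c ∈ V) (hG : IsOpen G) (hf : DifferentiableOn ℂ f G)
    (hproper : ∀ L ⊆ V, IsCompact L → IsCompact (G ∩ f ⁻¹' L))
    (hf' : ∀ z ∈ G, f z ≠ c → deriv f z ≠ 0) (hm : m ≠ 0)
    {ψ₀ : ℂ → ℂ} (hψ₀ : AnalyticAt ℂ ψ₀ 0) (hψ₀G : ψ₀ 0 ∈ G)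
    (hfψ₀ : ∀ᶠ ζ in 𝓝 0, f (ψ₀ ζ) = ζ ^ m + c) :
    ∃ ψ : ℂ → ℂ, DifferentiableOn ℂ ψ (rootDomain m V c) ∧ MapsTo ψ (rootDomain m V c) G ∧
      (∀ ζ ∈ rootDomain m V c, f (ψ ζ) = ζ ^ m + c) ∧ ψ 0 = ψ₀ 0 := by
  have hR : IsOpen (rootDomain m V c) := isOpen_rootDomain hV
  have h0 : 0 ∈ rootDomain m V c := zero_mem_rootDomain hm hc
  obtain ⟨ε, hε, hball⟩ := Metric.eventually_nhds_iff_ball.1 (hψ₀.eventually_analyticAt.and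
    (hfψ₀.and (hψ₀.continuousAt.eventually_mem (hG.mem_nhds hψ₀G))))
  obtain ⟨ψ, hψ, hψG, hfψ, heq⟩ := exists_root_section_extension hV hVc hG hf hproper hf' hε
    (fun ζ hζ => (hball ζ hζ).1.continuousAt.continuousWithinAt) (fun ζ hζ => (hball ζ hζ).2.2)
    fun ζ hζ => (hball ζ hζ).2.1
  have hψ0 : ψ 0 = ψ₀ 0 := heq ⟨h0, mem_ball_self hε⟩
  have hlocal : ψ =ᶠ[𝓝 0] ψ₀ :=
    heq.eventuallyEq_of_mem (inter_mem (hR.mem_nhds h0) (ball_mem_nhds 0 hε))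
  refine ⟨ψ, fun ζ hζ => DifferentiableAt.differentiableWithinAt ?_, fun ζ hζ => ?_,
    fun ζ hζ => ?_, hψ0⟩ <;> rcases eq_or_ne ζ 0 with rfl | hζ0
  · exact hψ₀.differentiableAt.congr_of_eventuallyEq hlocal
  · have hnhds := (hR.sdiff isClosed_singleton).mem_nhds ⟨hζ, hζ0⟩
    have hfψζ := hfψ ζ ⟨hζ, hζ0⟩
    refine differentiableAt_of_comp_eq (q := fun ζ => ζ ^ m + c) (hψ.continuousAt hnhds)
      (hf.analyticAt (hG.mem_nhds (hψG ⟨hζ, hζ0⟩))) (hf' _ (hψG ⟨hζ, hζ0⟩) ?_) (by fun_prop)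
      (mem_of_superset hnhds hfψ)
    simpa [hfψζ] using fun h => absurd h hζ0
  · exact hψ0 ▸ hψ₀G
  · exact hψG ⟨hζ, hζ0⟩
  · exact hψ0 ▸ hfψ₀.self_of_nhds
  · exact hfψ ζ ⟨hζ, hζ0⟩

theorem isCompact_setOf_pow_add_mem (hm : m ≠ 0) (c : ℂ) {L : Set ℂ} (hL : IsCompact L) :
    IsCompact {ζ : ℂ | ζ ^ m + c ∈ L} := by
  obtain ⟨M, hM⟩ := hL.isBounded.subset_closedBall c
  refine (isCompact_closedBall (0 : ℂ) (max 1 M)).of_isClosed_subset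
    (hL.isClosed.preimage (by fun_prop)) fun ζ hζ => mem_closedBall_zero_iff.2 ?_
  have hpow : ‖ζ‖ ^ m ≤ M := by simpa using hM hζ
  rcases le_total ‖ζ‖ 1 with h1 | h1
  · exact h1.trans (le_max_left _ _)
  · exact ((le_self_pow₀ h1 hm).trans hpow).trans (le_max_right _ _)

theorem inter_closure_image_root_section_subset (hV : IsOpen V) (hm : m ≠ 0)
    (hf : ContinuousOn f G) (hmaps : MapsTo f G V) {ψ : ℂ → ℂ}
    (hψ : ContinuousOn ψ (rootDomain m V c)) (hψG : MapsTo ψ (rootDomain m V c) G)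
    (hfψ : ∀ ζ ∈ rootDomain m V c, f (ψ ζ) = ζ ^ m + c) :
    closure (ψ '' rootDomain m V c) ∩ G ⊆ ψ '' rootDomain m V c := by
  rintro z ⟨hz, hzG⟩
  obtain ⟨u, hu, huz⟩ := mem_closure_iff_seq_limit.1 hz
  choose ζ hζ hζu using hu
  obtain rfl : (fun n => ψ (ζ n)) = u := funext hζu
  have hfu : Tendsto (fun n => ζ n ^ m + c) atTop (𝓝 (f z)) :=
    ((hf z hzG).tendsto.comp (tendsto_nhdsWithin_iff.2
      ⟨huz, Eventually.of_forall fun n => hψG (hζ n)⟩)).congr fun n => hfψ _ (hζ n)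
  obtain ⟨ξ, -, φ, hφ, hξ⟩ := (isCompact_setOf_pow_add_mem hm c
    hfu.isCompact_insert_range).tendsto_subseq (x := ζ) fun n => Or.inr ⟨n, rfl⟩
  have hξz : ξ ^ m + c = f z :=
    tendsto_nhds_unique ((hξ.pow m).add_const c) (hfu.comp hφ.tendsto_atTop)
  have hξR : ξ ∈ rootDomain m V c := by
    rw [mem_rootDomain, hξz]
    exact hmaps hzG
  exact ⟨ξ, hξR, tendsto_nhds_unique
    ((hψ.continuousAt ((isOpen_rootDomain hV).mem_nhds hξR)).tendsto.comp hξ)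
    (huz.comp hφ.tendsto_atTop)⟩

theorem isOpen_image_root_section (hV : IsOpen V) (hVc : StarConvex ℝ c V) (hc : c ∈ V)
    (hm : m ≠ 0) {ψ : ℂ → ℂ} (hψ : DifferentiableOn ℂ ψ (rootDomain m V c))
    (hfψ : ∀ ζ ∈ rootDomain m V c, f (ψ ζ) = ζ ^ m + c) :
    IsOpen (ψ '' rootDomain m V c) := by
  have hR : IsOpen (rootDomain m V c) := isOpen_rootDomain hV
  have h0 : 0 ∈ rootDomain m V c := zero_mem_rootDomain hm hc
  rcases (hψ.analyticOnNhd hR).is_constant_or_isOpen (isPreconnected_rootDomain hm hc hVc)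
    with ⟨w, hw⟩ | hopen
  · have hpunctured : ∀ᶠ ζ in 𝓝[≠] (0 : ℂ), ζ ∈ rootDomain m V c ∧ ζ ≠ 0 :=
      (eventually_nhdsWithin_of_eventually_nhds (hR.mem_nhds h0)).and self_mem_nhdsWithin
    obtain ⟨ζ, hζ, hζ0⟩ := hpunctured.exists
    have hpow : ζ ^ m + c = 0 ^ m + c := by rw [← hfψ ζ hζ, ← hfψ 0 h0, hw ζ hζ, hw 0 h0]
    simp [hm, hζ0] at hpow
  · exact hopen _ subset_rfl hR

theorem ncard_setOf_pow_eq (hd : d ≠ 0) {w : ℂ} (hw : w ≠ 0) : {ζ : ℂ | ζ ^ d = w}.ncard = d := by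
  have hprim := Complex.isPrimitiveRoot_exp d hd
  have hroots : {ζ : ℂ | ζ ^ d = w} = ((Polynomial.nthRoots d w).toFinset : Set ℂ) := by
    ext ζ
    simp [Polynomial.mem_nthRoots (Nat.pos_of_ne_zero hd)]
  rw [hroots, Set.ncard_coe_finset, Multiset.toFinset_card_of_nodup (hprim.nthRoots_nodup hw),
    hprim.card_nthRoots, if_pos (IsAlgClosed.exists_pow_nat_eq w (Nat.pos_of_ne_zero hd))]

theorem IsBranchedCovering.ncard_fiber (hf : IsBranchedCovering d f G V) (hG : IsOpen G) {w : ℂ}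
    (hw : w ∈ V) (hf' : ∀ z ∈ G, f z = w → deriv f z ≠ 0) : {z | z ∈ G ∧ f z = w}.ncard = d := by
  rw [← hf.degree w hw, ← finsum_one]
  refine (finsum_mem_congr rfl fun z hz => ?_).symm
  have horder := (hf.analytic.analyticAt
    (hG.mem_nhds hz.1)).analyticOrderAt_sub_eq_one_of_deriv_ne_zero (hf' z hz.1 hz.2)
  rw [analyticOrderNatAt, ← hz.2, horder, ENat.toNat_one]

theorem injOn_root_section (hf : IsBranchedCovering d f G V) (hG : IsOpen G) (hd : d ≠ 0)
    (hf' : ∀ z ∈ G, f z ≠ c → deriv f z ≠ 0) {ψ : ℂ → ℂ} (hψG : ψ '' rootDomain d V c = G)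
    (hfψ : ∀ ζ ∈ rootDomain d V c, f (ψ ζ) = ζ ^ d + c) : InjOn ψ (rootDomain d V c) := by
  intro ζ hζ ξ hξ hζξ
  have hpow : ξ ^ d = ζ ^ d := by simpa [hfψ ζ hζ, hfψ ξ hξ] using (congrArg f hζξ).symm
  rcases eq_or_ne ζ 0 with rfl | hζ0
  · rw [zero_pow hd] at hpow
    exact (pow_eq_zero_iff hd).1 hpow |>.symm
  have hζd : ζ ^ d ≠ 0 := pow_ne_zero d hζ0
  have hfiber : {z | z ∈ G ∧ f z = ζ ^ d + c} = ψ '' {x | x ^ d = ζ ^ d} := by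
    have hmem : ∀ x, x ^ d = ζ ^ d → x ∈ rootDomain d V c := fun x hx => by
      rwa [mem_rootDomain, hx]
    rw [← hψG]
    ext z
    constructor
    · rintro ⟨⟨x, hx, rfl⟩, hxζ⟩
      exact ⟨x, by simpa [hfψ x hx] using hxζ, rfl⟩
    · rintro ⟨x, hx, rfl⟩
      exact ⟨mem_image_of_mem ψ (hmem x hx), by rw [hfψ x (hmem x hx), show x ^ d = ζ ^ d from hx]⟩
  have hcard : (ψ '' {x | x ^ d = ζ ^ d}).ncard = {x : ℂ | x ^ d = ζ ^ d}.ncard := by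
    rw [ncard_setOf_pow_eq hd hζd, ← hfiber]
    exact hf.ncard_fiber hG hζ fun z hz hzw => hf' z hz (by simp [hzw, hζ0])
  have hfin : {x : ℂ | x ^ d = ζ ^ d}.Finite :=
    finite_of_ncard_ne_zero ((ncard_setOf_pow_eq hd hζd).trans_ne hd)
  exact Set.injOn_of_ncard_image_eq hcard hfin rfl hpow hζξ

theorem IsBranchedCovering.exists_surjOn_root_section (hf : IsBranchedCovering d f G V)
    (hV : IsOpen V) (hVc : StarConvex ℝ c V) (hG : IsOpen G) (hGc : IsPreconnected G) (hb : b ∈ G)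
    (hfb : f b = c) (hf' : ∀ z ∈ G, deriv f z = 0 → z = b) :
    ∃ m : ℕ, m ≠ 0 ∧ analyticOrderAt (fun z => f z - c) b = m ∧ ∃ ψ : ℂ → ℂ,
      DifferentiableOn ℂ ψ (rootDomain m V c) ∧ ψ '' rootDomain m V c = G ∧ ψ 0 = b ∧
      ∀ ζ ∈ rootDomain m V c, f (ψ ζ) = ζ ^ m + c := by
  have hc : c ∈ V := hfb ▸ hf.mapsTo hb
  have hana : AnalyticAt ℂ f b := hf.analytic.analyticAt (hG.mem_nhds hb)
  have htop : analyticOrderAt (fun z => f z - c) b ≠ ⊤ := by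
    refine analyticOrderAt_sub_ne_top_of_deriv_ne_zero ?_
    filter_upwards [nhdsWithin_le_nhds (hG.mem_nhds hb), self_mem_nhdsWithin] with z hz hzb h
    exact hzb (hf' z hz h)
  obtain ⟨m, hm⟩ := ENat.ne_top_iff_exists.1 htop
  have hm0 : m ≠ 0 := by
    rintro rfl
    exact (hana.sub analyticAt_const).analyticOrderAt_eq_zero.1 hm.symm (sub_eq_zero.2 hfb)
  obtain ⟨ψ₀, hψ₀, hψ₀b, -, hfψ₀⟩ := exists_local_root hana hm0 hm.symm
  obtain ⟨ψ, hψ, hψG, hfψ, hψ0⟩ := exists_differentiableOn_root_section hV hVc hc hG hf.analytic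
    hf.proper (fun z hz hzc h => hzc (hf' z hz h ▸ hfb)) hm0 hψ₀ (hψ₀b ▸ hb) hfψ₀
  have himage : ψ '' rootDomain m V c = G := subset_antisymm hψG.image_subset
    (hGc.subset_of_closure_inter_subset (isOpen_image_root_section hV hVc hc hm0 hψ hfψ)
      ⟨b, hb, 0, zero_mem_rootDomain hm0 hc, hψ0.trans hψ₀b⟩
      (inter_closure_image_root_section_subset hV hm0 hf.analytic.continuousOn hf.mapsTo
        hψ.continuousOn hψG hfψ))
  exact ⟨m, hm0, hm.symm, ψ, hψ, himage, hψ0.trans hψ₀b, hfψ⟩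

theorem IsBranchedCovering.exists_uniformization (hf : IsBranchedCovering d f G V) (hV : IsOpen V)
    (hVc : StarConvex ℝ c V) (hG : IsOpen G) (hGc : IsPreconnected G) (hb : b ∈ G)
    (hfb : f b = c) (hf' : ∀ z ∈ G, deriv f z = 0 → z = b) :
    ∃ ψ : ℂ → ℂ, IsUniformization d f G V c ψ ∧ ψ 0 = b := by
  obtain ⟨m, hm0, hm, ψ, hψ, himage, hψ0, hfψ⟩ :=
    hf.exists_surjOn_root_section hV hVc hG hGc hb hfb hf'
  have hfiber : {z | z ∈ G ∧ f z = c} = {b} := by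
    refine subset_antisymm ?_ (singleton_subset_iff.2 ⟨hb, hfb⟩)
    rw [← himage]
    rintro _ ⟨⟨ζ, hζ, rfl⟩, hζc⟩
    have hζ0 : ζ = 0 := by simpa [hfψ ζ hζ, hm0] using hζc
    rw [hζ0, hψ0, mem_singleton_iff]
  obtain rfl : m = d := by
    have hdegree := hf.degree c (hfb ▸ hf.mapsTo hb)
    rwa [hfiber, finsum_mem_singleton, analyticOrderNatAt, hm, ENat.toNat_natCast] at hdegree
  have hreg : ∀ z ∈ G, f z ≠ c → deriv f z ≠ 0 := fun z hz hzc h => hzc (hf' z hz h ▸ hfb)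
  exact ⟨ψ, ⟨hψ, injOn_root_section hf hG hm0 hreg himage hfψ, himage, hfψ⟩, hψ0⟩

end Uniformization

section UniformizedCovering

variable {d : ℕ} {f : ℂ → ℂ} {G V : Set ℂ} {c : ℂ} {ψ : ℂ → ℂ}

namespace IsUniformization

theorem invFunOn_mem (h : IsUniformization d f G V c ψ) {z : ℂ} (hz : z ∈ G) :
    Function.invFunOn ψ (rootDomain d V c) z ∈ rootDomain d V c :=
  Function.invFunOn_mem (h.image_eq.superset hz)

theorem apply_invFunOn (h : IsUniformization d f G V c ψ) {z : ℂ} (hz : z ∈ G) :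
    ψ (Function.invFunOn ψ (rootDomain d V c) z) = z :=
  Function.invFunOn_eq (h.image_eq.superset hz)

theorem eqOn_invFunOn_pow_add (h : IsUniformization d f G V c ψ) :
    EqOn f (fun z => Function.invFunOn ψ (rootDomain d V c) z ^ d + c) G := fun z hz => by
  simp only [← h.map_comp _ (h.invFunOn_mem hz), h.apply_invFunOn hz]

theorem differentiableOn_invFunOn (h : IsUniformization d f G V c ψ) (hV : IsOpen V) :
    DifferentiableOn ℂ (Function.invFunOn ψ (rootDomain d V c)) G :=
  h.image_eq ▸ differentiableOn_leftInvOn (isOpen_rootDomain hV) h.differentiableOn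
    h.injOn.leftInvOn_invFunOn

theorem isOpen_image (h : IsUniformization d f G V c ψ) (hV : IsOpen V) : IsOpen G :=
  h.image_eq ▸ isOpen_image_of_injOn (isOpen_rootDomain hV) h.differentiableOn h.injOn

theorem differentiableOn_map (h : IsUniformization d f G V c ψ) (hV : IsOpen V) :
    DifferentiableOn ℂ f G :=
  (((h.differentiableOn_invFunOn hV).pow d).add_const c).congr h.eqOn_invFunOn_pow_add

theorem deriv_eq_zero_iff (h : IsUniformization d f G V c ψ) (hV : IsOpen V) (hd : 1 < d)
    {ζ : ℂ} (hζ : ζ ∈ rootDomain d V c) : deriv f (ψ ζ) = 0 ↔ ζ = 0 := by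
  have hζ_nhds := (isOpen_rootDomain hV).mem_nhds hζ
  have hψ := (h.differentiableOn.differentiableAt hζ_nhds).hasDerivAt
  have hf := ((h.differentiableOn_map hV).differentiableAt
    ((h.isOpen_image hV).mem_nhds (h.image_eq ▸ mem_image_of_mem ψ hζ))).hasDerivAt
  have hcomp : HasDerivAt (f ∘ ψ) (d * ζ ^ (d - 1)) ζ :=
    ((hasDerivAt_pow d ζ).add_const c).congr_of_eventuallyEq
      (mem_of_superset hζ_nhds fun ξ hξ => h.map_comp ξ hξ)
  have hchain := (hf.comp ζ hψ).unique hcomp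
  have hψ' := deriv_ne_zero_of_injOn hζ_nhds h.differentiableOn h.injOn
  rw [← mul_eq_zero_iff_right hψ', hchain]
  simp [show d ≠ 0 by lia, show d - 1 ≠ 0 by lia]

theorem setOf_eq_image (h : IsUniformization d f G V c ψ) {w : ℂ} (hw : w ∈ V) :
    {z | z ∈ G ∧ f z = w} = ψ '' {ζ | ζ ^ d = w - c} := by
  ext z
  constructor
  · rintro ⟨hz, rfl⟩
    refine ⟨_, eq_sub_of_add_eq ?_, h.apply_invFunOn hz⟩
    exact (h.eqOn_invFunOn_pow_add hz).symm
  · rintro ⟨ζ, hζ, rfl⟩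
    have hζw : ζ ^ d + c = w := add_eq_of_eq_sub hζ
    have hζV : ζ ∈ rootDomain d V c := mem_rootDomain.2 (hζw ▸ hw)
    exact ⟨h.image_eq ▸ mem_image_of_mem ψ hζV, (h.map_comp ζ hζV).trans hζw⟩

theorem analyticOrderAt_sub_eq (h : IsUniformization d f G V c ψ) (hV : IsOpen V) (w : ℂ) {ζ : ℂ}
    (hζ : ζ ∈ rootDomain d V c) : analyticOrderAt (fun z => f z - w) (ψ ζ) =
      analyticOrderAt (fun ξ => ξ ^ d - (w - c)) ζ := by
  have hζ_nhds := (isOpen_rootDomain hV).mem_nhds hζ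
  rw [← analyticOrderAt_comp_of_deriv_ne_zero (h.differentiableOn.analyticAt hζ_nhds)
    (deriv_ne_zero_of_injOn hζ_nhds h.differentiableOn h.injOn)]
  refine analyticOrderAt_congr (mem_of_superset hζ_nhds fun ξ hξ => ?_)
  change f (ψ ξ) - w = ξ ^ d - (w - c)
  rw [h.map_comp ξ hξ]
  ring

theorem isCompact_inter_preimage (h : IsUniformization d f G V c ψ) (hd : d ≠ 0) {L : Set ℂ}
    (hLV : L ⊆ V) (hL : IsCompact L) : IsCompact (G ∩ f ⁻¹' L) := by
  have himage : G ∩ f ⁻¹' L = ψ '' {ζ | ζ ^ d + c ∈ L} := by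
    ext z
    constructor
    · rintro ⟨hz, hzL⟩
      refine ⟨_, ?_, h.apply_invFunOn hz⟩
      rwa [mem_preimage, h.eqOn_invFunOn_pow_add hz] at hzL
    · rintro ⟨ζ, hζL, rfl⟩
      refine ⟨h.image_eq ▸ mem_image_of_mem ψ (hLV hζL), ?_⟩
      rwa [mem_preimage, h.map_comp ζ (hLV hζL)]
  rw [himage]
  exact (isCompact_setOf_pow_add_mem hd c hL).image_of_continuousOn
    (h.differentiableOn.continuousOn.mono fun ζ hζ => hLV hζ)

end IsUniformization

theorem finsum_analyticOrderNatAt_pow_sub (hd : d ≠ 0) (w : ℂ) :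
    ∑ᶠ ζ ∈ {ζ : ℂ | ζ ^ d = w}, analyticOrderNatAt (fun ξ => ξ ^ d - w) ζ = d := by
  obtain rfl | hw := eq_or_ne w 0
  · have horder : analyticOrderAt (fun ξ : ℂ => ξ ^ d) 0 = d :=
      (analyticAt_id.pow d).analyticOrderAt_eq_natCast.2
        ⟨1, analyticAt_const, one_ne_zero, by simp⟩
    simp [hd, analyticOrderNatAt, horder]
  · refine Eq.trans (finsum_mem_congr rfl ?_) (finsum_one.trans (ncard_setOf_pow_eq hd hw))
    rintro ζ rfl
    have hderiv : deriv (fun ξ : ℂ => ξ ^ d) ζ ≠ 0 := by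
      simpa [hd] using fun h : ζ = 0 => (hw (by simp [h, hd])).elim
    rw [analyticOrderNatAt,
      (analyticAt_id.pow d).analyticOrderAt_sub_eq_one_of_deriv_ne_zero hderiv, ENat.toNat_one]

theorem IsUniformization.isBranchedCovering (h : IsUniformization d f G V c ψ) (hV : IsOpen V)
    (hd : d ≠ 0) : IsBranchedCovering d f G V where
  analytic := h.differentiableOn_map hV
  mapsTo z hz := by
    rw [h.eqOn_invFunOn_pow_add hz]
    exact h.invFunOn_mem hz
  proper _ := h.isCompact_inter_preimage hd
  degree w hw := by
    have hroots : {ζ : ℂ | ζ ^ d = w - c} ⊆ rootDomain d V c := fun ζ hζ =>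
      mem_rootDomain.2 ((add_eq_of_eq_sub hζ).symm ▸ hw)
    rw [h.setOf_eq_image hw, finsum_mem_image (h.injOn.mono hroots)]
    refine (finsum_mem_congr rfl fun ζ hζ => ?_).trans
      (finsum_analyticOrderNatAt_pow_sub hd (w - c))
    rw [analyticOrderNatAt, h.analyticOrderAt_sub_eq hV w (hroots hζ), analyticOrderNatAt]

theorem isUniformization_invFunOn_pow_add (hψ : DifferentiableOn ℂ ψ (rootDomain d V c))
    (hinj : InjOn ψ (rootDomain d V c)) :
    IsUniformization d (fun z => Function.invFunOn ψ (rootDomain d V c) z ^ d + c)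
      (ψ '' rootDomain d V c) V c ψ where
  differentiableOn := hψ
  injOn := hinj
  image_eq := rfl
  map_comp ζ hζ := by rw [hinj.leftInvOn_invFunOn hζ]

theorem isSimplyConnected_image_of_injOn {U : Set ℂ} {a : ℂ} (hU : IsOpen U)
    (hUa : StarConvex ℝ a U) (ha : a ∈ U) (hψ : DifferentiableOn ℂ ψ U) (hinj : InjOn ψ U) :
    IsSimplyConnected (ψ '' U) := by
  have hemb : IsOpenEmbedding (U.domRestrict ψ) := by
    refine IsOpenEmbedding.of_continuous_injective_isOpenMap hψ.continuousOn.domRestrict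
      (injOn_iff_injective.1 hinj) fun s hs => ?_
    have hsU : Subtype.val '' s ⊆ U := Subtype.coe_image_subset U s
    have hopen := isOpen_image_of_injOn (hU.isOpenMap_subtype_val s hs) (hψ.mono hsU)
      (hinj.mono hsU)
    rwa [image_image] at hopen
  have : ContractibleSpace U := hUa.contractibleSpace ⟨a, ha⟩
  have hsimply : SimplyConnectedSpace (range (U.domRestrict ψ)) :=
    hemb.isEmbedding.toHomeomorph.toHomotopyEquiv.simplyConnectedSpace_iff.1 inferInstance
  rwa [range_domRestrict] at hsimply

end UniformizedCovering

section RealUniformization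

variable {d : ℕ} {f ψ : ℂ → ℂ} {G V : Set ℂ} {J : Set ℝ}

theorem IsUniformization.comp_mul {c ω : ℂ} (h : IsUniformization d f G V c ψ) (hd : d ≠ 0)
    (hω : ω ^ d = 1) : IsUniformization d f G V c fun ζ => ψ (ω * ζ) := by
  have hω0 : ω ≠ 0 := by
    rintro rfl
    simp [hd] at hω
  have hpow : ∀ ζ, (ω * ζ) ^ d = ζ ^ d := fun ζ => by rw [mul_pow, hω, one_mul]
  have hmem : ∀ ζ, ω * ζ ∈ rootDomain d V c ↔ ζ ∈ rootDomain d V c := fun ζ => by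
    rw [mem_rootDomain, mem_rootDomain, hpow]
  have himage : (ω * ·) '' rootDomain d V c = rootDomain d V c := by
    refine subset_antisymm (image_subset_iff.2 fun ζ hζ => (hmem ζ).2 hζ) fun ζ hζ => ?_
    have hζω : ω * (ω⁻¹ * ζ) = ζ := mul_inv_cancel_left₀ hω0 ζ
    exact ⟨ω⁻¹ * ζ, (hmem _).1 (hζω.symm ▸ hζ), hζω⟩
  refine ⟨h.differentiableOn.comp (by fun_prop) fun ζ hζ => (hmem ζ).2 hζ, ?_, ?_, ?_⟩
  · exact h.injOn.comp (mul_right_injective₀ hω0).injOn fun ζ hζ => (hmem ζ).2 hζ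
  · rw [← h.image_eq, ← image_image ψ, himage]
  · intro ζ hζ
    rw [h.map_comp _ ((hmem ζ).2 hζ), hpow]

theorem IsUniformization.exists_apply_eq {c l z : ℂ} (h : IsUniformization d f G V c ψ)
    (hd : d ≠ 0) (hl : l ≠ 0) (hz : z ∈ G) (hfz : f z = l ^ d + c) :
    ∃ ψ' : ℂ → ℂ, IsUniformization d f G V c ψ' ∧ ψ' 0 = ψ 0 ∧ ψ' l = z := by
  set ζ := Function.invFunOn ψ (rootDomain d V c) z
  have hζ : ζ ^ d = l ^ d :=
    add_right_cancel ((h.eqOn_invFunOn_pow_add hz).symm.trans hfz)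
  refine ⟨_, h.comp_mul (ω := ζ / l) hd ?_, by rw [mul_zero], ?_⟩
  · rw [div_pow, hζ, div_self (pow_ne_zero d hl)]
  · rw [div_mul_cancel₀ _ hl, h.apply_invFunOn hz]

theorem eqOn_of_pow_eq {X : Type*} [TopologicalSpace X] {S : Set X} (hS : IsPreconnected S)
    {p q : X → ℂ} (hp : ContinuousOn p S) (hq : ContinuousOn q S) (hd : d ≠ 0)
    (hpq : ∀ x ∈ S, p x ^ d = q x ^ d) (hq0 : ∀ x ∈ S, q x ≠ 0) {a : X} (ha : a ∈ S)
    (hpa : p a = q a) : EqOn p q S := fun x hx => by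
  have hroots : {ζ : ℂ | ζ ^ d = 1}.Finite :=
    finite_of_ncard_ne_zero ((ncard_setOf_pow_eq hd one_ne_zero).trans_ne hd)
  have hmaps : MapsTo (fun x => p x / q x) S {ζ | ζ ^ d = 1} := fun y hy => by
    rw [mem_ofPred_eq, div_pow, hpq y hy, div_self (pow_ne_zero d (hq0 y hy))]
  have hconst := hS.constant_of_mapsTo hroots.isDiscrete (hp.div hq hq0) hmaps hx ha
  refine (div_eq_one_iff_eq (hq0 x hx)).1 (hconst.trans ?_)
  rw [Pi.div_apply, hpa, div_self (hq0 a ha)]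

theorem IsUniformization.exists_apply_ofReal_eq {c : ℂ} (h : IsUniformization d f G V c ψ)
    (hV : IsOpen V) (hd : d ≠ 0) {r : ℝ → ℝ} (hr : ContinuousOn r (Icc 0 1)) (hr0 : r 0 = 0)
    (hr_ne : ∀ x ∈ Ioc (0 : ℝ) 1, r x ≠ 0) (hG : ∀ x ∈ Icc (0 : ℝ) 1, (x : ℂ) ∈ G)
    (hf : ∀ x ∈ Icc (0 : ℝ) 1, f x = r x ^ d + c) (h1 : ψ (r 1) = 1) {t : ℝ}
    (ht : t ∈ Icc 0 (r 1)) : ∃ x : ℝ, ψ t = x := by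
  set P := Function.invFunOn ψ (rootDomain d V c)
  have hPr : ∀ x ∈ Icc (0 : ℝ) 1, P x ^ d = (r x : ℂ) ^ d := fun x hx =>
    add_right_cancel ((h.eqOn_invFunOn_pow_add (hG x hx)).symm.trans (hf x hx))
  have hP1 : P (1 : ℝ) = r 1 := by
    have hmem : (r 1 : ℂ) ∈ rootDomain d V c := by
      rw [mem_rootDomain, ← hPr 1 (right_mem_Icc.2 zero_le_one)]
      exact h.invFunOn_mem (hG 1 (right_mem_Icc.2 zero_le_one))
    rw [Complex.ofReal_one, ← h1]
    exact h.injOn.leftInvOn_invFunOn hmem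
  have hPeq : EqOn (fun x : ℝ => P x) (fun x => (r x : ℂ)) (Ioc 0 1) :=
    eqOn_of_pow_eq isPreconnected_Ioc
      ((h.differentiableOn_invFunOn hV).continuousOn.comp
        Complex.continuous_ofReal.continuousOn fun x hx => hG x (Ioc_subset_Icc_self hx))
      (Complex.continuous_ofReal.comp_continuousOn (hr.mono Ioc_subset_Icc_self)) hd
      (fun x hx => hPr x (Ioc_subset_Icc_self hx))
      (fun x hx => Complex.ofReal_ne_zero.2 (hr_ne x hx)) (right_mem_Ioc.2 zero_lt_one) hP1
  obtain ⟨x, hx, rfl⟩ := intermediate_value_Icc zero_le_one hr (hr0.symm ▸ ht)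
  have hPx : P x = r x := by
    rcases hx.1.eq_or_lt with rfl | hx0
    · simpa [hr0, hd] using hPr 0 hx
    · exact hPeq ⟨hx0, hx.2⟩
  exact ⟨x, by rw [← hPx, h.apply_invFunOn (hG x hx)]⟩

/-- A uniformization `ψ` of a covering of the slit plane of `J`, normalized by `ψ 0 = 0` and
`ψ l = 1`, that is real on `[0, l]`; hence it maps `[0, l]` onto `[0, 1]`. -/
structure IsRealUniformization (d : ℕ) (f : ℂ → ℂ) (G : Set ℂ) (J : Set ℝ) (c l : ℝ)
    (ψ : ℂ → ℂ) : Prop extends IsUniformization d f G (slitPlane J) c ψ where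
  map_zero : ψ 0 = 0
  map_length : ψ l = 1
  im_eq_zero : ∀ t ∈ Icc (0 : ℝ) l, (ψ t).im = 0

theorem ofReal_mem_rootDomain {c t : ℝ} :
    (t : ℂ) ∈ rootDomain d (slitPlane J) c ↔ t ^ d + c ∈ J := by
  rw [mem_rootDomain, ← ofReal_mem_slitPlane]
  push_cast
  rfl

theorem pow_add_mem_Icc {c l t : ℝ} (ht : t ∈ Icc 0 l) : t ^ d + c ∈ Icc c (l ^ d + c) :=
  ⟨le_add_of_nonneg_left (pow_nonneg ht.1 d), by gcongr; exacts [ht.1, ht.2]⟩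

theorem ofReal_mem_rootDomain_of_mem_Icc {c l t : ℝ}
    (hJ : Icc c (l ^ d + c) ⊆ J) (ht : t ∈ Icc 0 l) : (t : ℂ) ∈ rootDomain d (slitPlane J) c :=
  ofReal_mem_rootDomain.2 (hJ (pow_add_mem_Icc ht))

theorem IsEpsteinMap.exists_isRealUniformization {g : ℝ → ℝ} (h : IsEpsteinMap 1 g J G f) {l : ℝ}
    (hl : 0 < l) (hl3 : l ^ 3 = g 1 - g 0) : ∃ ψ, IsRealUniformization 3 f G J (g 0) l ψ := by
  obtain ⟨-, hmono, hcont, hJ, hJc, himage, hG, hGs, hGI, hext, hcov, hbranch⟩ := h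
  rw [uIcc_of_le zero_le_one] at hmono hcont himage hGI hext
  have h0 : (0 : ℝ) ∈ Icc (0 : ℝ) 1 := left_mem_Icc.2 zero_le_one
  have h1 : (1 : ℝ) ∈ Icc (0 : ℝ) 1 := right_mem_Icc.2 zero_le_one
  have hV := isOpen_slitPlane hJ
  obtain ⟨ψ₁, hψ₁, hψ₁0⟩ := hcov.exists_uniformization (b := 0) hV
    (starConvex_slitPlane hJc (himage (mem_image_of_mem g h0))) hG
    hGs.isPathConnected.isConnected.isPreconnected (by simpa using hGI 0 h0)
    (by simpa using hext 0 h0) fun z hz => (hbranch z hz).1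
  obtain ⟨ψ, hψ, hψ0, hψl⟩ := hψ₁.exists_apply_eq (l := l) (z := 1) three_ne_zero
    (Complex.ofReal_ne_zero.2 hl.ne') (by simpa using hGI 1 h1) (by
      have hf1 : f 1 = g 1 := by simpa using hext 1 h1
      rw [hf1, ← Complex.ofReal_pow, ← Complex.ofReal_add, hl3, sub_add_cancel])
  let r : ℝ → ℝ := fun x => (g x - g 0) ^ ((3 : ℕ) : ℝ)⁻¹
  have hr3 : ∀ x ∈ Icc (0 : ℝ) 1, r x ^ 3 = g x - g 0 := fun x hx =>
    Real.rpow_inv_natCast_pow (sub_nonneg.2 (hmono.monotoneOn h0 hx hx.1)) three_ne_zero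
  have hr1 : r 1 = l := by
    simp only [r, ← hl3]
    exact Real.pow_rpow_inv_natCast hl.le three_ne_zero
  refine ⟨ψ, hψ, hψ0.trans hψ₁0, hψl, fun t ht => ?_⟩
  obtain ⟨x, hx⟩ := hψ.exists_apply_ofReal_eq (r := r) hV three_ne_zero
    ((hcont.sub continuousOn_const).rpow_const fun x _ => Or.inr (by positivity))
    (by simp [r]) (fun x hx => (Real.rpow_pos_of_pos (sub_pos.2
      (hmono h0 (Ioc_subset_Icc_self hx) hx.1)) _).ne') hGI
    (fun x hx => by
      rw [← Complex.ofReal_pow, ← Complex.ofReal_add, hr3 x hx, sub_add_cancel, hext x hx])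
    (hr1.symm ▸ hψl) (hr1.symm ▸ ht)
  rw [hx, Complex.ofReal_im]

namespace IsRealUniformization

variable {c l : ℝ}

theorem apply_ofReal (h : IsRealUniformization d f G J c l ψ) {t : ℝ} (ht : t ∈ Icc 0 l) :
    ψ t = ((ψ t).re : ℂ) :=
  Complex.ext rfl (h.im_eq_zero t ht)

theorem continuousOn_re (h : IsRealUniformization d f G J c l ψ) (hJ : Icc c (l ^ d + c) ⊆ J) :
    ContinuousOn (fun t : ℝ => (ψ t).re) (Icc 0 l) :=
  Complex.continuous_re.comp_continuousOn (h.differentiableOn.continuousOn.comp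
    Complex.continuous_ofReal.continuousOn fun _ => ofReal_mem_rootDomain_of_mem_Icc hJ)

theorem strictMonoOn_re (h : IsRealUniformization d f G J c l ψ) (hl : 0 ≤ l)
    (hJ : Icc c (l ^ d + c) ⊆ J) : StrictMonoOn (fun t : ℝ => (ψ t).re) (Icc 0 l) := by
  refine (h.continuousOn_re hJ).strictMonoOn_of_injOn_Icc hl ?_ fun t ht t' ht' htt' => ?_
  · simp [h.map_zero, h.map_length]
  · refine Complex.ofReal_injective (h.injOn (ofReal_mem_rootDomain_of_mem_Icc hJ ht)
      (ofReal_mem_rootDomain_of_mem_Icc hJ ht') ?_)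
    rw [h.apply_ofReal ht, h.apply_ofReal ht']
    exact congrArg _ htt'

theorem exists_apply_eq_ofReal (h : IsRealUniformization d f G J c l ψ) (hl : 0 ≤ l)
    (hJ : Icc c (l ^ d + c) ⊆ J) {x : ℝ} (hx : x ∈ Icc (0 : ℝ) 1) : ∃ t ∈ Icc 0 l, ψ t = x := by
  obtain ⟨t, ht, rfl⟩ := intermediate_value_Icc hl (h.continuousOn_re hJ)
    (show x ∈ Icc _ _ by simpa [h.map_zero, h.map_length] using hx)
  exact ⟨t, ht, h.apply_ofReal ht⟩

theorem map_apply_ofReal (h : IsRealUniformization d f G J c l ψ) (hJ : Icc c (l ^ d + c) ⊆ J)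
    {t : ℝ} (ht : t ∈ Icc 0 l) : f (ψ t) = ((t ^ d + c : ℝ) : ℂ) := by
  rw [h.map_comp _ (ofReal_mem_rootDomain_of_mem_Icc hJ ht)]
  push_cast
  rfl

theorem strictMonoOn_map (h : IsRealUniformization d f G J c l ψ) (hd : d ≠ 0) (hl : 0 ≤ l)
    (hJ : Icc c (l ^ d + c) ⊆ J) : StrictMonoOn (fun x : ℝ => (f x).re) (Icc 0 1) := by
  intro x hx y hy hxy
  obtain ⟨t, ht, htx⟩ := h.exists_apply_eq_ofReal hl hJ hx
  obtain ⟨t', ht', hty⟩ := h.exists_apply_eq_ofReal hl hJ hy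
  have htt' : t < t' := by
    rw [← (h.strictMonoOn_re hl hJ).lt_iff_lt ht ht']
    simpa [htx, hty] using hxy
  simp only [← htx, ← hty, h.map_apply_ofReal hJ ht, h.map_apply_ofReal hJ ht',
    Complex.ofReal_re]
  gcongr
  exact ht.1

theorem deriv_eq_zero_iff (h : IsRealUniformization d f G J c l ψ) (hJ : IsOpen J) (hcJ : c ∈ J)
    (hd : 1 < d) {z : ℂ} (hz : z ∈ G) : deriv f z = 0 ↔ z = 0 := by
  rw [← h.image_eq] at hz
  obtain ⟨ζ, hζ, rfl⟩ := hz
  rw [h.toIsUniformization.deriv_eq_zero_iff (isOpen_slitPlane hJ) hd hζ]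
  nth_rewrite 2 [← h.map_zero]
  exact (h.injOn.eq_iff hζ (zero_mem_rootDomain (by lia) (ofReal_mem_slitPlane.2 hcJ))).symm

theorem isEpsteinMap (h : IsRealUniformization 3 f G J c l ψ) (hJ : IsOpen J)
    (hJc : J.OrdConnected) (hl : 0 ≤ l) (hsub : Icc c (l ^ 3 + c) ⊆ J) :
    IsEpsteinMap 1 (fun x => (f x).re) J G f := by
  have hcJ : c ∈ J := hsub (left_mem_Icc.2 (le_add_of_nonneg_left (pow_nonneg hl 3)))
  have hV := isOpen_slitPlane hJ
  have hGI : ∀ x ∈ Icc (0 : ℝ) 1, (x : ℂ) ∈ G ∧ ∃ t ∈ Icc 0 l, f x = ((t ^ 3 + c : ℝ) : ℂ) := by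
    intro x hx
    obtain ⟨t, ht, htx⟩ := h.exists_apply_eq_ofReal hl hsub hx
    rw [← htx]
    exact ⟨h.image_eq ▸ mem_image_of_mem ψ (ofReal_mem_rootDomain_of_mem_Icc hsub ht), t, ht,
      h.map_apply_ofReal hsub ht⟩
  have hcov := h.isBranchedCovering hV three_ne_zero
  have hstar := starConvex_slitPlane hJc hcJ
  rw [← uIcc_of_le (zero_le_one' ℝ)] at hGI
  refine ⟨one_ne_zero, uIcc_of_le (zero_le_one' ℝ) ▸ h.strictMonoOn_map three_ne_zero hl hsub,
    ?_, hJ, hJc, ?_, h.isOpen_image hV, h.image_eq ▸ ?_, fun x hx => (hGI x hx).1, ?_, hcov,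
    fun z hz => h.deriv_eq_zero_iff hJ hcJ (by norm_num) hz⟩
  · exact Complex.continuous_re.comp_continuousOn (hcov.analytic.continuousOn.comp
      Complex.continuous_ofReal.continuousOn fun x hx => (hGI x hx).1)
  · rintro _ ⟨x, hx, rfl⟩
    obtain ⟨-, t, ht, hfx⟩ := hGI x hx
    simp only [hfx, Complex.ofReal_re]
    exact hsub (pow_add_mem_Icc ht)
  · exact isSimplyConnected_image_of_injOn (isOpen_rootDomain hV) (starConvex_rootDomain hstar)
      (zero_mem_rootDomain three_ne_zero (ofReal_mem_slitPlane.2 hcJ)) h.differentiableOn h.injOn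
  · intro x hx
    obtain ⟨-, t, -, hfx⟩ := hGI x hx
    rw [hfx, Complex.ofReal_re]

end IsRealUniformization

end RealUniformization

section Bounds

theorem setDist_Icc {a b c d : ℝ} (hab : a ≤ b) (hcd : c ≤ d) :
    setDist (Icc a b) (Icc c d) = max 0 (max (c - b) (a - d)) := by
  refine IsLeast.csInf_eq ⟨?_, ?_⟩
  · rcases le_total b c with hbc | hcb
    · refine ⟨b, ⟨hab, le_rfl⟩, c, ⟨le_rfl, hcd⟩, ?_⟩
      rw [Real.dist_eq, abs_sub_comm, abs_of_nonneg (sub_nonneg.2 hbc),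
        max_eq_left (a := c - b) (by linarith), max_eq_right (sub_nonneg.2 hbc)]
    rcases le_total d a with hda | had
    · refine ⟨a, ⟨le_rfl, hab⟩, d, ⟨hcd, le_rfl⟩, ?_⟩
      rw [Real.dist_eq, abs_of_nonneg (sub_nonneg.2 hda),
        max_eq_right (a := c - b) (by linarith), max_eq_right (sub_nonneg.2 hda)]
    · refine ⟨max a c, ⟨le_max_left _ _, max_le hab hcb⟩, max a c,
        ⟨le_max_right _ _, max_le had hcd⟩, ?_⟩
      rw [dist_self, max_eq_left (max_le (sub_nonpos.2 hcb) (sub_nonpos.2 had))]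
  · rintro _ ⟨x, hx, y, hy, rfl⟩
    rw [Real.dist_eq]
    exact max_le (abs_nonneg _) (max_le (by linarith [neg_abs_le (x - y), hx.2, hy.1])
      (by linarith [le_abs_self (x - y), hx.1, hy.2]))

variable {J : Set ℝ} {c d e x : ℝ}

theorem connectedComponentIn_sdiff_Icc_of_lt (hJ : J.OrdConnected) (hcd : c ≤ d) (hx : x ∈ J)
    (hxc : x < c) : connectedComponentIn (J \ Icc c d) x = J ∩ Iio c := by
  have hsub : J ∩ Iio c ⊆ J \ Icc c d := fun z hz => ⟨hz.1, fun h => not_lt.2 h.1 hz.2⟩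
  refine subset_antisymm (fun z hz => ⟨(connectedComponentIn_subset _ _ hz).1, ?_⟩)
    ((hJ.inter ordConnected_Iio).isPreconnected.subset_connectedComponentIn ⟨hx, hxc⟩ hsub)
  refine mem_Iio.2 <| lt_of_not_ge fun hcz => (connectedComponentIn_subset (J \ Icc c d) x ?_).2
    (left_mem_Icc.2 hcd)
  exact isPreconnected_connectedComponentIn.ordConnected.out
    (mem_connectedComponentIn (hsub ⟨hx, hxc⟩)) hz ⟨hxc.le, hcz⟩

theorem connectedComponentIn_sdiff_Icc_of_gt (hJ : J.OrdConnected) (hcd : c ≤ d) (hx : x ∈ J)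
    (hdx : d < x) : connectedComponentIn (J \ Icc c d) x = J ∩ Ioi d := by
  have hsub : J ∩ Ioi d ⊆ J \ Icc c d := fun z hz => ⟨hz.1, fun h => not_lt.2 h.2 hz.2⟩
  refine subset_antisymm (fun z hz => ⟨(connectedComponentIn_subset _ _ hz).1, ?_⟩)
    ((hJ.inter ordConnected_Ioi).isPreconnected.subset_connectedComponentIn ⟨hx, hdx⟩ hsub)
  refine mem_Ioi.2 <| lt_of_not_ge fun hzd => (connectedComponentIn_subset (J \ Icc c d) x ?_).2
    (right_mem_Icc.2 hcd)
  exact isPreconnected_connectedComponentIn.ordConnected.out hz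
    (mem_connectedComponentIn (hsub ⟨hx, hdx⟩)) ⟨hzd, hdx.le⟩

theorem le_volume_inter_Iio_iff (hJ : J.OrdConnected) (hc : c ∈ J) :
    ENNReal.ofReal e ≤ volume (J ∩ Iio c) ↔ Ioo (c - e) c ⊆ J := by
  refine ⟨fun h y hy => ?_, fun h => ?_⟩
  · by_contra hyJ
    have hsub : J ∩ Iio c ⊆ Ioo y c := fun z hz =>
      ⟨lt_of_not_ge fun hzy => hyJ (hJ.out hz.1 hc ⟨hzy, hy.2.le⟩), hz.2⟩
    have hvol := h.trans (measure_mono hsub)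
    rw [Real.volume_Ioo, ENNReal.ofReal_le_ofReal_iff (sub_nonneg.2 hy.2.le)] at hvol
    linarith [hy.1]
  · have hvol := measure_mono (μ := volume) (subset_inter h fun z (hz : z ∈ Ioo (c - e) c) => hz.2)
    rwa [Real.volume_Ioo, sub_sub_cancel] at hvol

theorem le_volume_inter_Ioi_iff (hJ : J.OrdConnected) (hd : d ∈ J) :
    ENNReal.ofReal e ≤ volume (J ∩ Ioi d) ↔ Ioo d (d + e) ⊆ J := by
  refine ⟨fun h y hy => ?_, fun h => ?_⟩
  · by_contra hyJ
    have hsub : J ∩ Ioi d ⊆ Ioo d y := fun z hz =>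
      ⟨hz.2, lt_of_not_ge fun hyz => hyJ (hJ.out hd hz.1 ⟨hy.1.le, hyz⟩)⟩
    have hvol := h.trans (measure_mono hsub)
    rw [Real.volume_Ioo, ENNReal.ofReal_le_ofReal_iff (sub_nonneg.2 hy.1.le)] at hvol
    linarith [hy.2]
  · have hvol := measure_mono (μ := volume) (subset_inter h fun z (hz : z ∈ Ioo d (d + e)) => hz.1)
    rwa [Real.volume_Ioo, add_sub_cancel_left] at hvol

theorem forall_le_volume_connectedComponentIn_iff (hJ : IsOpen J) (hJc : J.OrdConnected)
    (hcd : c ≤ d) (hsub : Icc c d ⊆ J) :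
    (∀ x ∈ J \ Icc c d, ENNReal.ofReal e ≤ volume (connectedComponentIn (J \ Icc c d) x)) ↔
      Ioo (c - e) (d + e) ⊆ J := by
  have hc : c ∈ J := hsub (left_mem_Icc.2 hcd)
  have hd : d ∈ J := hsub (right_mem_Icc.2 hcd)
  constructor
  · intro h y hy
    rcases lt_or_ge y c with hyc | hcy
    · obtain ⟨x, hx, hxc⟩ := Filter.nonempty_of_mem (inter_mem
        (nhdsWithin_le_nhds (s := Iio c) (hJ.mem_nhds hc)) self_mem_nhdsWithin)
      have hvol := h x ⟨hx, fun h => h.1.not_gt hxc⟩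
      rw [connectedComponentIn_sdiff_Icc_of_lt hJc hcd hx hxc] at hvol
      exact (le_volume_inter_Iio_iff hJc hc).1 hvol ⟨hy.1, hyc⟩
    rcases le_or_gt y d with hyd | hdy
    · exact hsub ⟨hcy, hyd⟩
    · obtain ⟨x, hx, hdx⟩ := Filter.nonempty_of_mem (inter_mem
        (nhdsWithin_le_nhds (s := Ioi d) (hJ.mem_nhds hd)) self_mem_nhdsWithin)
      have hvol := h x ⟨hx, fun h => h.2.not_gt hdx⟩
      rw [connectedComponentIn_sdiff_Icc_of_gt hJc hcd hx hdx] at hvol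
      exact (le_volume_inter_Ioi_iff hJc hd).1 hvol ⟨hdy, hy.2⟩
  · rintro h x ⟨hx, hxcd⟩
    rcases lt_or_ge x c with hxc | hcx
    · rw [connectedComponentIn_sdiff_Icc_of_lt hJc hcd hx hxc, le_volume_inter_Iio_iff hJc hc]
      exact fun z hz => h ⟨hz.1, by linarith [hz.1, hz.2]⟩
    · have hdx : d < x := lt_of_not_ge fun hxd => hxcd ⟨hcx, hxd⟩
      rw [connectedComponentIn_sdiff_Icc_of_gt hJc hcd hx hdx, le_volume_inter_Ioi_iff hJc hd]
      exact fun z hz => h ⟨by linarith [hz.1, hz.2], hz.2⟩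

theorem commensurable_inv_iff {s y : ℝ} (hx : 0 ≤ x) (hy : 0 ≤ y) :
    Commensurable s⁻¹ x y ↔ x / y ∈ Icc s s⁻¹ := by
  rw [Commensurable, inv_inv, abs_of_nonneg hx, abs_of_nonneg hy, mem_Icc]

/-- The conditions of `HasBounds` for `I = [0, 1]`, as closed conditions on the end points of the
image `[c, d]` of `I` and on the larger interval `J`. -/
structure EndpointBounds (s c d : ℝ) (J : Set ℝ) : Prop where
  length : 1 / (d - c) ∈ Icc s s⁻¹
  distance : max 0 (max (c - 1) (-d)) / (d - c) ∈ Icc s s⁻¹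
  space : Ioo (c - s * (d - c)) (d + s * (d - c)) ⊆ J

theorem hasBounds_iff {s : ℝ} {g : ℝ → ℝ} (hJ : IsOpen J) (hJc : J.OrdConnected) (hcd : c ≤ d)
    (hg : g '' uIcc 0 1 = Icc c d) (hsub : Icc c d ⊆ J) :
    HasBounds s 1 g J ↔ EndpointBounds s c d J := by
  have hdiam : diam (g '' uIcc 0 1) = d - c := by rw [hg, Real.diam_Icc hcd]
  have hdiam_one : diam (uIcc (0 : ℝ) 1) = 1 := by
    rw [uIcc_of_le zero_le_one, Real.diam_Icc zero_le_one, sub_zero]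
  have hdist : setDist (uIcc 0 1) (g '' uIcc 0 1) = max 0 (max (c - 1) (-d)) := by
    rw [hg, uIcc_of_le zero_le_one, setDist_Icc zero_le_one hcd, zero_sub]
  have hlength : Commensurable s⁻¹ (diam (uIcc (0 : ℝ) 1)) (diam (g '' uIcc 0 1)) ↔
      1 / (d - c) ∈ Icc s s⁻¹ := by
    rw [hdiam, hdiam_one, commensurable_inv_iff zero_le_one (sub_nonneg.2 hcd)]
  have hdistance : Commensurable s⁻¹ (setDist (uIcc 0 1) (g '' uIcc 0 1))
      (diam (g '' uIcc 0 1)) ↔ max 0 (max (c - 1) (-d)) / (d - c) ∈ Icc s s⁻¹ := by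
    rw [hdist, hdiam, commensurable_inv_iff (le_max_left _ _) (sub_nonneg.2 hcd)]
  have hspace : (∀ x ∈ J \ g '' uIcc 0 1, ENNReal.ofReal (s * diam (g '' uIcc 0 1)) ≤
      volume (connectedComponentIn (J \ g '' uIcc 0 1) x)) ↔
      Ioo (c - s * (d - c)) (d + s * (d - c)) ⊆ J := by
    rw [hdiam, hg, forall_le_volume_connectedComponentIn_iff hJ hJc hcd hsub]
  exact ⟨fun h => ⟨hlength.1 h.length, hdistance.1 h.distance, hspace.1 h.space⟩,
    fun h => ⟨hlength.2 h.length, hdistance.2 h.distance, hspace.2 h.space⟩⟩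

end Bounds

/-- Kernel convergence of a sequence of regions `W n` to `U`: the `W n` exhaust `U`, and no boundary
point of `U` has a neighbourhood contained in infinitely many `W n`. It says that `U` is a union of
components of the kernels of the subsequences, without reference to marked points. -/
structure KernelConverges {X : Type*} [TopologicalSpace X] (W : ℕ → Set X) (U : Set X) : Prop where
  exhausts : CompactlyExhausts atTop W U
  mem_of_frequently : ∀ z ∈ closure U, ∀ V ∈ 𝓝 z, (∃ᶠ n in atTop, V ⊆ W n) → z ∈ U

theorem KernelConverges.comp {X : Type*} [TopologicalSpace X] {W : ℕ → Set X} {U : Set X}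
    (h : KernelConverges W U) {φ : ℕ → ℕ} (hφ : Tendsto φ atTop atTop) :
    KernelConverges (fun n => W (φ n)) U :=
  ⟨h.exhausts.comp hφ, fun z hz V hV hVW => h.mem_of_frequently z hz V hV (hφ.frequently hVW)⟩

section Normality

variable {W : ℕ → Set ℂ} {U : Set ℂ} {ψ : ℕ → ℂ → ℂ} {q : ℕ → ℂ} {a b z : ℂ} {r M N : ℝ}

theorem exists_eventually_norm_le_ball_half (hψ : ∀ n, DifferentiableOn ℂ (ψ n) (W n))
    (hinj : ∀ n, InjOn (ψ n) (W n)) (hzW : ∀ᶠ n in atTop, ball z r ⊆ W n)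
    (hz : ∀ᶠ n in atTop, ‖ψ n z‖ ≤ M) (hqW : ∀ᶠ n in atTop, q n ∈ W n \ ball z r)
    (hq : ∀ᶠ n in atTop, ‖ψ n (q n)‖ ≤ N) :
    ∃ C : ℝ, ∀ᶠ n in atTop, ∀ x ∈ ball z (r / 2), ‖ψ n x‖ ≤ C := by
  refine ⟨Real.exp 384 * (M + N) + N, ?_⟩
  filter_upwards [hzW, hz, hqW, hq] with n hzW hz hqW hq x hx
  have homit : ∀ y ∈ ball z r, ψ n y ≠ ψ n (q n) := fun y hy heq =>
    hqW.2 (hinj n (hzW hy) hqW.1 heq ▸ hy)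
  calc ‖ψ n x‖ = ‖ψ n x - ψ n (q n) + ψ n (q n)‖ := by rw [sub_add_cancel]
    _ ≤ ‖ψ n x - ψ n (q n)‖ + ‖ψ n (q n)‖ := norm_add_le _ _
    _ ≤ Real.exp 384 * ‖ψ n z - ψ n (q n)‖ + N := add_le_add
      (norm_sub_le_of_injOn_of_omits ((hψ n).mono hzW) ((hinj n).mono hzW) homit hx) hq
    _ ≤ Real.exp 384 * (M + N) + N := by
      gcongr
      exact (norm_sub_le _ _).trans (add_le_add hz hq)

theorem CompactlyExhausts.exists_ball_subset (hU : IsOpen U) (hW : CompactlyExhausts atTop W U)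
    (hz : z ∈ U) : ∃ r > 0, ∀ᶠ n in atTop, ball z r ⊆ W n := by
  obtain ⟨K, hK, -, -, hKW⟩ := hW.exists_mem_nhds (hU.mem_nhds hz)
  obtain ⟨r, hr, hrK⟩ := Metric.mem_nhds_iff.1 hK
  exact ⟨r, hr, hKW.mono fun n hn => hrK.trans hn⟩

theorem CompactlyExhausts.eventually_mem_of_tendsto (hU : IsOpen U)
    (hW : CompactlyExhausts atTop W U) (hq : Tendsto q atTop (𝓝 b)) (hb : b ∈ U) :
    ∀ᶠ n in atTop, q n ∈ W n := by
  obtain ⟨r, hr, hrW⟩ := hW.exists_ball_subset hU hb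
  filter_upwards [hrW, hq (ball_mem_nhds b hr)] with n hn hqn using hn hqn

theorem exists_mem_nhds_eventually_norm_le_of_ne (hU : IsOpen U)
    (hW : CompactlyExhausts atTop W U) (hψ : ∀ n, DifferentiableOn ℂ (ψ n) (W n))
    (hinj : ∀ n, InjOn (ψ n) (W n)) (hz : z ∈ U) (hzM : ∀ᶠ n in atTop, ‖ψ n z‖ ≤ M)
    (hq : Tendsto q atTop (𝓝 b)) (hb : b ∈ U) (hqN : ∀ᶠ n in atTop, ‖ψ n (q n)‖ ≤ N)
    (hzb : z ≠ b) : ∃ V ∈ 𝓝 z, ∃ C : ℝ, ∀ᶠ n in atTop, ∀ x ∈ V, ‖ψ n x‖ ≤ C := by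
  obtain ⟨r, hr, hrW⟩ := hW.exists_ball_subset hU hz
  have hρ : 0 < min r (dist b z / 2) := lt_min hr (half_pos (dist_pos.2 hzb.symm))
  have hqρ : ∀ᶠ n in atTop, q n ∉ ball z (min r (dist b z / 2)) := by
    have hb : dist b z / 2 < dist b z := half_lt_self (dist_pos.2 hzb.symm)
    filter_upwards [(hq.dist tendsto_const_nhds).eventually (lt_mem_nhds hb)] with n hn hqn
    exact hn.not_ge ((mem_ball.1 hqn).le.trans (min_le_right _ _))
  exact ⟨_, ball_mem_nhds z (half_pos hρ), exists_eventually_norm_le_ball_half hψ hinj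
    (hrW.mono fun n hn => (ball_subset_ball (min_le_left _ _)).trans hn) hzM
    ((hW.eventually_mem_of_tendsto hU hq hb).and hqρ) hqN⟩

theorem exists_mem_nhds_eventually_norm_le_of_mem_closure (hU : IsOpen U)
    (hW : CompactlyExhausts atTop W U) (hψ : ∀ n, DifferentiableOn ℂ (ψ n) (W n))
    (hinj : ∀ n, InjOn (ψ n) (W n)) (ha : a ∈ U) (haM : ∀ᶠ n in atTop, ‖ψ n a‖ ≤ M) (hz : z ∈ U)
    (hza : z ≠ a) (hcl : z ∈ closure {x | ∃ C : ℝ, ∀ᶠ n in atTop, ‖ψ n x‖ ≤ C}) :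
    ∃ V ∈ 𝓝 z, ∃ C : ℝ, ∀ᶠ n in atTop, ∀ x ∈ V, ‖ψ n x‖ ≤ C := by
  obtain ⟨r₀, hr₀, hrW⟩ := hW.exists_ball_subset hU hz
  have hr : 0 < min r₀ (dist a z) := lt_min hr₀ (dist_pos.2 hza.symm)
  set r := min r₀ (dist a z)
  obtain ⟨y, ⟨C, hC⟩, hyz⟩ := Metric.mem_closure_iff.1 hcl (r / 8) (by positivity)
  have hyr : ball y (3 * r / 4) ⊆ ball z r := ball_subset_ball' (by rw [dist_comm]; linarith)
  have hay : a ∉ ball y (3 * r / 4) := fun h => (mem_ball.1 (hyr h)).not_ge (min_le_right _ _)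
  have hzy : z ∈ ball y (3 * r / 4 / 2) := mem_ball.2 (by linarith)
  exact ⟨_, isOpen_ball.mem_nhds hzy, exists_eventually_norm_le_ball_half hψ hinj
    (hrW.mono fun n hn => (hyr.trans (ball_subset_ball (min_le_left _ _))).trans hn) hC
    ((hW.eventually_mem ha).mono fun n hn => ⟨hn, hay⟩) haM⟩

theorem exists_mem_nhds_eventually_norm_le (hU : IsOpen U) (hUc : IsPreconnected U)
    (hW : CompactlyExhausts atTop W U) (hψ : ∀ n, DifferentiableOn ℂ (ψ n) (W n))
    (hinj : ∀ n, InjOn (ψ n) (W n)) (ha : a ∈ U) (haM : ∀ᶠ n in atTop, ‖ψ n a‖ ≤ M)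
    (hq : Tendsto q atTop (𝓝 b)) (hb : b ∈ U) (hqN : ∀ᶠ n in atTop, ‖ψ n (q n)‖ ≤ N)
    (hab : a ≠ b) (hz : z ∈ U) :
    ∃ V ∈ 𝓝 z, ∃ C : ℝ, ∀ᶠ n in atTop, ∀ x ∈ V, ‖ψ n x‖ ≤ C := by
  set S : Set ℂ := {z | ∃ V ∈ 𝓝 z, ∃ C : ℝ, ∀ᶠ n in atTop, ∀ x ∈ V, ‖ψ n x‖ ≤ C}
  have hSo : IsOpen S := isOpen_iff_mem_nhds.2 fun x ⟨V, hV, hC⟩ =>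
    (eventually_mem_nhds_iff.2 hV).mono fun y hy => ⟨V, hy, hC⟩
  have haS : a ∈ S :=
    exists_mem_nhds_eventually_norm_le_of_ne hU hW hψ hinj ha haM hq hb hqN hab
  refine hUc.subset_of_closure_inter_subset hSo ⟨a, ha, haS⟩ ?_ hz
  rintro x ⟨hxS, hxU⟩
  obtain rfl | hxa := eq_or_ne x a
  · exact haS
  · refine exists_mem_nhds_eventually_norm_le_of_mem_closure hU hW hψ hinj ha haM hxU hxa
      (closure_mono ?_ hxS)
    rintro y ⟨V, hV, C, hC⟩
    exact ⟨C, hC.mono fun n hn => hn y (mem_of_mem_nhds hV)⟩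

end Normality

section KernelImage

variable {W : ℕ → Set ℂ} {U B : Set ℂ} {F ψ Q : ℕ → ℂ → ℂ} {f Ψ R : ℂ → ℂ} {b z : ℂ} {r : ℝ}

theorem tendstoLocallyUniformlyOn_comp_index {ι κ α β : Type*} [TopologicalSpace α] [UniformSpace β]
    {F : ι → α → β} {f : α → β} {s : Set α} {l : Filter ι} {l' : Filter κ} {φ : κ → ι}
    (h : TendstoLocallyUniformlyOn F f l s) (hφ : Tendsto φ l' l) :
    TendstoLocallyUniformlyOn (fun k => F (φ k)) f l' s :=
  fun u hu x hx => (h u hu x hx).imp fun _ ht => ⟨ht.1, hφ.eventually ht.2⟩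

theorem KernelConverges.preimage (h : KernelConverges W U) (hU : IsOpen U)
    (hF : ∀ n, Differentiable ℂ (F n)) (hFf : TendstoLocallyUniformlyOn F f atTop univ)
    (hne : ∀ z, ∀ᶠ x in 𝓝[≠] z, f x ≠ f z) :
    KernelConverges (fun n => F n ⁻¹' W n) (f ⁻¹' U) := by
  have hexh : CompactlyExhausts atTop (fun _ : ℕ => (univ : Set ℂ)) univ :=
    fun _ _ _ => Eventually.of_forall fun _ => subset_univ _
  have hF' : ∀ n, DifferentiableOn ℂ (F n) univ := fun n => (hF n).differentiableOn
  have hf : Continuous f := continuousOn_univ.1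
    (differentiableOn_of_tendstoLocallyUniformlyOn isOpen_univ hexh hF' hFf).continuousOn
  refine ⟨CompactlyExhausts.of_forall_eventually fun z hz => ?_, fun z hz V hV hVW => ?_⟩
  · obtain ⟨K, hK, -, -, hKW⟩ := h.exhausts.exists_mem_nhds (hU.mem_nhds hz)
    have hlim := tendsto_prod_of_tendstoLocallyUniformlyOn isOpen_univ hFf hf.continuousOn
      (mem_univ z)
    filter_upwards [hlim hK, hKW.prod_inl (𝓝 z)] with p hp hpW using hpW hp
  · obtain ⟨N, hN, V', hV', hNV⟩ := mem_prod_iff.1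
      (eventually_mem_image_of_tendstoLocallyUniformlyOn isOpen_univ hexh hF' hFf (mem_univ z)
        (hne z) hV)
    refine h.mem_of_frequently (f z) (hf.closure_preimage_subset U hz) V' hV' ?_
    refine (hVW.and_eventually hN).mono fun n hn y hy => ?_
    obtain ⟨x, hx, rfl⟩ : y ∈ F n '' V := hNV (mk_mem_prod hn.2 hy)
    exact hn.1 hx

theorem exists_eventually_norm_leftInvOn_le (hU : IsOpen U) (hW : CompactlyExhausts atTop W U)
    (hWo : ∀ n, IsOpen (W n)) (hψ : ∀ n, DifferentiableOn ℂ (ψ n) (W n))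
    (hQ : ∀ n, LeftInvOn (Q n) (ψ n) (W n)) (hψΨ : TendstoLocallyUniformlyOn ψ Ψ atTop U)
    (hinj : InjOn Ψ U) (hb : b ∈ Ψ '' U) {a : ℂ} (ha : a ∈ U) (hab : Ψ a ∉ closedBall b r)
    (hbW : ∀ n, ball b r ⊆ ψ n '' W n) :
    ∃ C : ℝ, ∀ᶠ n in atTop, ∀ x ∈ ball b (r / 2), ‖Q n x‖ ≤ C := by
  obtain ⟨β, hβ, rfl⟩ := hb
  have hQβ : Tendsto (fun n => Q n (Ψ β)) atTop (𝓝 β) :=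
    (tendsto_prod_leftInvOn hU hW hψ hψΨ hQ hinj hβ).comp
      (tendsto_id.prodMk tendsto_const_nhds)
  have hψa : Tendsto (fun n => ψ n a) atTop (𝓝 (Ψ a)) := hψΨ.tendsto_at ha
  have haW := hW.eventually_mem ha
  refine exists_eventually_norm_le_ball_half (W := fun n => ψ n '' W n) (q := fun n => ψ n a)
    (M := ‖β‖ + 1) (N := ‖a‖) (fun n => differentiableOn_leftInvOn (hWo n) (hψ n) (hQ n))
    (fun n => LeftInvOn.injOn (hQ n).rightInvOn_image) (Eventually.of_forall hbW)
    ((hQβ.norm.eventually (gt_mem_nhds (lt_add_one ‖β‖))).mono fun n hn => hn.le) ?_ ?_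
  · filter_upwards [haW, hψa (isClosed_closedBall.isOpen_compl.mem_nhds hab)] with n hn hna
    exact ⟨mem_image_of_mem _ hn, fun h => hna (ball_subset_closedBall h)⟩
  · filter_upwards [haW] with n hn
    rw [hQ n hn]

theorem eventually_ne_of_eqOn_leftInvOn {p : ℂ → ℂ} (hp : LeftInvOn p Ψ U) (hU : IsOpen (Ψ '' U))
    (hB : IsOpen B) (hBc : IsPreconnected B) (hR : DifferentiableOn ℂ R B)
    (hRp : EqOn R p (B ∩ Ψ '' U)) (hne : (B ∩ Ψ '' U).Nonempty) (hzB : z ∈ B) :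
    ∀ᶠ x in 𝓝[≠] z, R x ≠ R z := by
  have hRinj : InjOn R (B ∩ Ψ '' U) :=
    ((LeftInvOn.injOn hp.rightInvOn_image).mono inter_subset_right).congr hRp.symm
  obtain ⟨b, hb⟩ := hne
  have hbn : B ∩ Ψ '' U ∈ 𝓝 b := (hB.inter hU).mem_nhds hb
  obtain ⟨x, hxb, hx⟩ :=
    ((eventually_ne_of_injOn hbn hRinj).and (mem_nhdsWithin_of_mem_nhds hbn)).exists
  exact eventually_ne_of_isPreconnected hB hBc hR hx.1 hb.1 hxb hzB

theorem KernelConverges.mem_image_of_tendstoLocallyUniformlyOn (h : KernelConverges W U)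
    (hU : IsOpen U) (hWo : ∀ n, IsOpen (W n)) (hψ : ∀ n, DifferentiableOn ℂ (ψ n) (W n))
    (hQ : ∀ n, LeftInvOn (Q n) (ψ n) (W n)) (hψΨ : TendstoLocallyUniformlyOn ψ Ψ atTop U)
    (hinj : InjOn Ψ U) (hB : IsOpen B) (hBc : IsPreconnected B) (hBW : ∀ n, B ⊆ ψ n '' W n)
    (hQR : TendstoLocallyUniformlyOn Q R atTop B) (hzB : z ∈ B) (hz : z ∈ closure (Ψ '' U)) :
    z ∈ Ψ '' U := by
  have hΨ := differentiableOn_of_tendstoLocallyUniformlyOn hU h.exhausts hψ hψΨ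
  have hexh : CompactlyExhausts atTop (fun _ : ℕ => B) B :=
    fun _ hK _ => Eventually.of_forall fun _ => hK
  have hQd : ∀ n, DifferentiableOn ℂ (Q n) B :=
    fun n => (differentiableOn_leftInvOn (hWo n) (hψ n) (hQ n)).mono (hBW n)
  have hR := differentiableOn_of_tendstoLocallyUniformlyOn hB hexh hQd hQR
  have hRU : ∀ ζ ∈ U, Ψ ζ ∈ B → R (Ψ ζ) = ζ := fun ζ hζ hζB =>
    tendsto_nhds_unique (hQR.tendsto_at hζB)
      ((tendsto_prod_leftInvOn hU h.exhausts hψ hψΨ hQ hinj hζ).comp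
        (tendsto_id.prodMk tendsto_const_nhds))
  have hzcl : z ∈ closure (B ∩ Ψ '' U) := hB.inter_closure ⟨hzB, hz⟩
  have hRcl : R z ∈ closure U :=
    ((hR.continuousOn z hzB).mono inter_subset_left).mem_closure hzcl <| by
      rintro _ ⟨hζB, ζ, hζ, rfl⟩
      rwa [hRU ζ hζ hζB]
  have hne : ∀ᶠ x in 𝓝[≠] z, R x ≠ R z := by
    refine eventually_ne_of_eqOn_leftInvOn hinj.leftInvOn_invFunOn
      (isOpen_image_of_injOn hU hΨ hinj) hB hBc hR ?_ (closure_nonempty_iff.1 ⟨z, hzcl⟩) hzB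
    rintro _ ⟨hζB, ζ, hζ, rfl⟩
    rw [hRU ζ hζ hζB, hinj.leftInvOn_invFunOn hζ]
  obtain ⟨N, hN, V, hV, hNV⟩ := mem_prod_iff.1
    (eventually_mem_image_of_tendstoLocallyUniformlyOn hB hexh hQd hQR hzB hne (hB.mem_nhds hzB))
  have hRzU : R z ∈ U := by
    refine h.mem_of_frequently _ hRcl V hV (Eventually.frequently ?_)
    filter_upwards [hN] with n hn y hy
    obtain ⟨x, hx, rfl⟩ : y ∈ Q n '' B := hNV (mk_mem_prod hn hy)
    obtain ⟨ζ, hζ, rfl⟩ := hBW n hx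
    rwa [hQ n hζ]
  refine ⟨R z, hRzU, tendsto_nhds_unique
    ((tendsto_prod_of_tendstoLocallyUniformlyOn hU hψΨ hΨ.continuousOn hRzU).comp
      (tendsto_id.prodMk (hQR.tendsto_at hzB))) (tendsto_const_nhds.congr fun n => ?_)⟩
  exact ((hQ n).rightInvOn_image (hBW n hzB)).symm

theorem KernelConverges.mem_image_of_mem_closure (h : KernelConverges W U) (hU : IsOpen U)
    (hWo : ∀ n, IsOpen (W n)) (hψ : ∀ n, DifferentiableOn ℂ (ψ n) (W n))
    (hψinj : ∀ n, InjOn (ψ n) (W n)) (hψΨ : TendstoLocallyUniformlyOn ψ Ψ atTop U)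
    (hinj : InjOn Ψ U) (hz : z ∈ closure (Ψ '' U)) (hr : 0 < r)
    (hzW : ∀ n, ball z r ⊆ ψ n '' W n) : z ∈ Ψ '' U := by
  by_contra hzU
  obtain ⟨_, ⟨a, ha, rfl⟩⟩ := closure_nonempty_iff.1 ⟨z, hz⟩
  have hza : 0 < dist (Ψ a) z := dist_pos.2 fun heq => hzU ⟨a, ha, heq⟩
  set ρ := min r (dist (Ψ a) z)
  have hρ : 0 < ρ := lt_min hr hza
  obtain ⟨b, hb, hzb⟩ := Metric.mem_closure_iff.1 hz (ρ / 4) (by positivity)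
  have hbz : ball b (3 * ρ / 4) ⊆ ball z r :=
    ball_subset_ball' (by linarith [dist_comm b z, min_le_left r (dist (Ψ a) z)])
  have hab : Ψ a ∉ closedBall b (3 * ρ / 4) := by
    intro h
    linarith [mem_closedBall.1 h, dist_triangle (Ψ a) b z, dist_comm b z,
      min_le_right r (dist (Ψ a) z)]
  have hQ : ∀ n, LeftInvOn (Function.invFunOn (ψ n) (W n)) (ψ n) (W n) :=
    fun n => (hψinj n).leftInvOn_invFunOn
  obtain ⟨C, hC⟩ := exists_eventually_norm_leftInvOn_le hU h.exhausts hWo hψ hQ hψΨ hinj hb ha hab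
    fun n => hbz.trans (hzW n)
  have hBW : ∀ n, ball b (3 * ρ / 4 / 2) ⊆ ψ n '' W n :=
    fun n => ((ball_subset_ball (by linarith)).trans hbz).trans (hzW n)
  obtain ⟨φ, hφ, R, hR⟩ := exists_subseq_tendstoLocallyUniformlyOn isOpen_ball
    (W := fun _ => ball b (3 * ρ / 4 / 2)) (fun _ hK _ => Eventually.of_forall fun _ => hK)
    (fun n => (differentiableOn_leftInvOn (hWo n) (hψ n) (hQ n)).mono (hBW n))
    fun x hx => ⟨_, isOpen_ball.mem_nhds hx, C, hC⟩
  exact hzU ((h.comp hφ.tendsto_atTop).mem_image_of_tendstoLocallyUniformlyOn hU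
    (fun n => hWo (φ n)) (fun n => hψ (φ n)) (fun n => hQ (φ n))
    (tendstoLocallyUniformlyOn_comp_index hψΨ hφ.tendsto_atTop) hinj isOpen_ball
    (convex_ball _ _).isPreconnected (fun n => hBW (φ n)) hR (mem_ball.2 (by linarith)) hz)

theorem KernelConverges.image (h : KernelConverges W U) (hU : IsOpen U)
    (hWo : ∀ n, IsOpen (W n)) (hψ : ∀ n, DifferentiableOn ℂ (ψ n) (W n))
    (hψinj : ∀ n, InjOn (ψ n) (W n)) (hψΨ : TendstoLocallyUniformlyOn ψ Ψ atTop U)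
    (hinj : InjOn Ψ U) : KernelConverges (fun n => ψ n '' W n) (Ψ '' U) := by
  refine ⟨h.exhausts.image hU hψ hψΨ hinj, fun z hz V hV hVW => ?_⟩
  obtain ⟨r, hr, hrV⟩ := Metric.mem_nhds_iff.1 hV
  obtain ⟨φ, hφ, hφV⟩ := extraction_of_frequently_atTop hVW
  exact (h.comp hφ.tendsto_atTop).mem_image_of_mem_closure hU (fun n => hWo (φ n))
    (fun n => hψ (φ n)) (fun n => hψinj (φ n))
    (tendstoLocallyUniformlyOn_comp_index hψΨ hφ.tendsto_atTop) hinj hz hr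
    fun n => hrV.trans (hφV n)

end KernelImage

section Caratheodory

variable {A : ℕ → Set (OnePoint ℂ)} {K O : Set (OnePoint ℂ)} {W : ℕ → Set ℂ} {U : Set ℂ}
  {u : ℕ → ℂ} {v : ℂ}

theorem eventually_subset_of_tendsto_vietoris
    (h : Tendsto A atTop (@nhds _ (TopologicalSpace.vietoris (OnePoint ℂ)) K)) (hO : IsOpen O)
    (hK : K ⊆ O) : ∀ᶠ n in atTop, A n ⊆ O :=
  let _ := TopologicalSpace.vietoris (OnePoint ℂ)
  h.eventually (hO.powerset_vietoris.mem_nhds hK)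

theorem eventually_inter_nonempty_of_tendsto_vietoris
    (h : Tendsto A atTop (@nhds _ (TopologicalSpace.vietoris (OnePoint ℂ)) K)) (hO : IsOpen O)
    (hK : (K ∩ O).Nonempty) : ∀ᶠ n in atTop, (A n ∩ O).Nonempty :=
  let _ := TopologicalSpace.vietoris (OnePoint ℂ)
  h.eventually ((TopologicalSpace.vietoris.isOpen_inter_nonempty_of_isOpen hO).mem_nhds hK)

theorem coe_mem_sphereCompl {z : ℂ} : (z : OnePoint ℂ) ∈ sphereCompl U ↔ z ∉ U := by
  rw [sphereCompl, mem_compl_iff, OnePoint.coe_injective.mem_set_image]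

theorem infty_mem_sphereCompl : OnePoint.infty ∈ sphereCompl U :=
  OnePoint.infty_notMem_image_coe

theorem infty_mem_of_tendsto_sphereCompl
    (h : Tendsto (fun n => sphereCompl (W n)) atTop
      (@nhds _ (TopologicalSpace.vietoris (OnePoint ℂ)) K)) : OnePoint.infty ∈ K := by
  by_contra hK
  obtain ⟨n, hn⟩ := (eventually_subset_of_tendsto_vietoris h isOpen_compl_singleton
    (subset_compl_singleton_iff.2 hK)).exists
  exact hn infty_mem_sphereCompl rfl

theorem CompactlyExhausts.image_coe_subset_compl (hW : CompactlyExhausts atTop W U)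
    (hU : IsOpen U)
    (h : Tendsto (fun n => sphereCompl (W n)) atTop
      (@nhds _ (TopologicalSpace.vietoris (OnePoint ℂ)) K)) :
    (fun z : ℂ => (z : OnePoint ℂ)) '' U ⊆ Kᶜ := by
  rintro _ ⟨z, hz, rfl⟩ hzK
  obtain ⟨r, hr, hrW⟩ := hW.exists_ball_subset hU hz
  obtain ⟨n, ⟨_, hn, y, hy, rfl⟩, hnW⟩ := ((eventually_inter_nonempty_of_tendsto_vietoris h
    (OnePoint.isOpenEmbedding_coe.isOpenMap _ (isOpen_ball (x := z) (ε := r)))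
    ⟨(z : OnePoint ℂ), hzK, mem_image_of_mem _ (mem_ball_self hr)⟩).and hrW).exists
  exact coe_mem_sphereCompl.1 hn (hnW hy)

theorem exists_ball_eventually_subset_of_notMem {z : ℂ} (hK : IsClosed K)
    (h : Tendsto (fun n => sphereCompl (W n)) atTop
      (@nhds _ (TopologicalSpace.vietoris (OnePoint ℂ)) K)) (hz : (z : OnePoint ℂ) ∉ K) :
    ∃ r > 0, ∀ᶠ n in atTop, ball z r ⊆ W n := by
  obtain ⟨r, hr, hrK⟩ := Metric.nhds_basis_closedBall.mem_iff.1
    ((hK.isOpen_compl.preimage OnePoint.continuous_coe).mem_nhds hz)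
  have hdisj : K ⊆ ((fun z : ℂ => (z : OnePoint ℂ)) '' closedBall z r)ᶜ := by
    rintro _ hx ⟨y, hy, rfl⟩
    exact hrK hy hx
  have hcl := ((isCompact_closedBall z r).image OnePoint.continuous_coe).isClosed
  refine ⟨r, hr, (eventually_subset_of_tendsto_vietoris h hcl.isOpen_compl hdisj).mono
    fun n hn y hy => ?_⟩
  by_contra hyW
  exact hn (coe_mem_sphereCompl.2 hyW) (mem_image_of_mem _ (ball_subset_closedBall hy))

theorem KernelConverges.image_coe_eq_connectedComponentIn (h : KernelConverges W U)
    (hU : IsOpen U) (hUc : IsPreconnected U) (hv : v ∈ U) (hK : IsClosed K)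
    (hlim : Tendsto (fun n => sphereCompl (W n)) atTop
      (@nhds _ (TopologicalSpace.vietoris (OnePoint ℂ)) K)) :
    (fun z : ℂ => (z : OnePoint ℂ)) '' U = connectedComponentIn Kᶜ (v : OnePoint ℂ) := by
  have hUK := h.exhausts.image_coe_subset_compl hU hlim
  have hvU : (v : OnePoint ℂ) ∈ (fun z : ℂ => (z : OnePoint ℂ)) '' U := mem_image_of_mem _ hv
  have hUc' := hUc.image _ OnePoint.continuous_coe.continuousOn
  refine subset_antisymm (hUc'.subset_connectedComponentIn hvU hUK) ?_
  refine isPreconnected_connectedComponentIn.subset_of_closure_inter_subset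
    (OnePoint.isOpenEmbedding_coe.isOpenMap _ hU) ⟨_, mem_connectedComponentIn (hUK hvU), hvU⟩ ?_
  rintro x ⟨hxcl, hxcomp⟩
  have hxK : x ∉ K := connectedComponentIn_subset _ _ hxcomp
  induction x using OnePoint.rec with
  | infty => exact absurd (infty_mem_of_tendsto_sphereCompl hlim) hxK
  | coe z =>
    obtain ⟨r, hr, hrW⟩ := exists_ball_eventually_subset_of_notMem hK hlim hxK
    refine mem_image_of_mem _ (h.mem_of_frequently z ?_ _ (ball_mem_nhds z hr) hrW.frequently)
    rwa [OnePoint.isOpenEmbedding_coe.isInducing.closure_eq_preimage_closure_image]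

theorem KernelConverges.caratheodoryConverges (h : KernelConverges W U) (hU : IsOpen U)
    (hUc : IsPreconnected U) (hu : Tendsto u atTop (𝓝 v)) (hv : v ∈ U) :
    CaratheodoryConverges W u U v := by
  refine ⟨hu, hv, ?_⟩
  rintro K ⟨hK, φ, hφ, hlim⟩
  exact (h.comp hφ.tendsto_atTop).image_coe_eq_connectedComponentIn hU hUc hv hK.isClosed hlim

end Caratheodory

section SlitPlaneLimits

/-- The open, possibly unbounded, interval of reals between two extended reals. -/
def realIoo (α β : EReal) : Set ℝ :=
  {x | α < x ∧ x < β}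

theorem isOpen_realIoo (α β : EReal) : IsOpen (realIoo α β) :=
  isOpen_Ioo.preimage continuous_coe_real_ereal

theorem ordConnected_realIoo (α β : EReal) : (realIoo α β).OrdConnected :=
  ordConnected_Ioo.preimage_mono EReal.coe_strictMono.monotone

theorem exists_eq_realIoo {J : Set ℝ} (hJ : IsOpen J) (hJc : J.OrdConnected) :
    ∃ α β : EReal, J = realIoo α β := by
  refine ⟨sInf ((↑) '' J), sSup ((↑) '' J), Subset.antisymm (fun x hx => ?_) ?_⟩
  · obtain ⟨a, b, hxab, hab⟩ := mem_nhds_iff_exists_Ioo_subset.1 (hJ.mem_nhds hx)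
    obtain ⟨y, hay, hyx⟩ := exists_between hxab.1
    obtain ⟨z, hxz, hzb⟩ := exists_between hxab.2
    have hy : y ∈ J := hab ⟨hay, hyx.trans hxab.2⟩
    have hz : z ∈ J := hab ⟨hxab.1.trans hxz, hzb⟩
    exact ⟨(sInf_le (mem_image_of_mem _ hy)).trans_lt (EReal.coe_lt_coe hyx),
      (EReal.coe_lt_coe hxz).trans_le (le_sSup (mem_image_of_mem _ hz))⟩
  · rintro x ⟨hαx, hxβ⟩
    obtain ⟨_, ⟨y, hy, rfl⟩, hyx⟩ := sInf_lt_iff.1 hαx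
    obtain ⟨_, ⟨z, hz, rfl⟩, hxz⟩ := lt_sSup_iff.1 hxβ
    exact hJc.out hy hz ⟨(EReal.coe_lt_coe_iff.1 hyx).le, (EReal.coe_lt_coe_iff.1 hxz).le⟩

variable {α β : ℕ → EReal} {α' β' : EReal} {a b : ℕ → ℝ} {a' b' x : ℝ}

theorem mem_realIoo_of_frequently_subset (hα : Tendsto α atTop (𝓝 α'))
    (hβ : Tendsto β atTop (𝓝 β')) {V : Set ℝ} (hV : V ∈ 𝓝 x)
    (h : ∃ᶠ n in atTop, V ⊆ realIoo (α n) (β n)) : x ∈ realIoo α' β' := by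
  obtain ⟨c, d, hx, hcd⟩ := mem_nhds_iff_exists_Ioo_subset.1 hV
  obtain ⟨y, hcy, hyx⟩ := exists_between hx.1
  obtain ⟨z, hxz, hzd⟩ := exists_between hx.2
  have hy : y ∈ V := hcd ⟨hcy, hyx.trans hx.2⟩
  have hz : z ∈ V := hcd ⟨hx.1.trans hxz, hzd⟩
  exact ⟨(le_of_tendsto_of_frequently hα (h.mono fun n hn => (hn hy).1.le)).trans_lt
      (EReal.coe_lt_coe hyx),
    (EReal.coe_lt_coe hxz).trans_le (ge_of_tendsto_of_frequently hβ
      (h.mono fun n hn => (hn hz).2.le))⟩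

theorem Ioo_subset_realIoo_of_tendsto (hα : Tendsto α atTop (𝓝 α')) (hβ : Tendsto β atTop (𝓝 β'))
    (ha : Tendsto a atTop (𝓝 a')) (hb : Tendsto b atTop (𝓝 b'))
    (h : ∀ n, Ioo (a n) (b n) ⊆ realIoo (α n) (β n)) : Ioo a' b' ⊆ realIoo α' β' := by
  rintro x ⟨hax, hxb⟩
  obtain ⟨y, hay, hyx⟩ := exists_between hax
  obtain ⟨z, hxz, hzb⟩ := exists_between hxb
  refine mem_realIoo_of_frequently_subset hα hβ (Ioo_mem_nhds hyx hxz) (Eventually.frequently ?_)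
  filter_upwards [ha.eventually_lt_const hay, hb.eventually_const_lt hzb] with n hn hn'
  exact (Ioo_subset_Ioo hn.le hn'.le).trans (h n)

theorem kernelConverges_slitPlane_realIoo (hα : Tendsto α atTop (𝓝 α'))
    (hβ : Tendsto β atTop (𝓝 β')) :
    KernelConverges (fun n => slitPlane (realIoo (α n) (β n))) (slitPlane (realIoo α' β')) := by
  refine ⟨CompactlyExhausts.of_forall_eventually fun z hz => ?_, fun z _ V hV hVW => ?_⟩
  · simp only [mem_slitPlane] at hz ⊢
    rcases hz with hz | hz
    · filter_upwards [(Complex.continuous_im.continuousAt.eventually_ne hz).prod_inr atTop]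
        with p hp using Or.inl hp
    · have hre : Tendsto (fun p : ℕ × ℂ => (p.2.re : EReal)) (atTop ×ˢ 𝓝 z) (𝓝 (z.re : EReal)) :=
        ((continuous_coe_real_ereal.comp Complex.continuous_re).tendsto z).comp tendsto_snd
      filter_upwards [(hα.comp tendsto_fst).eventually_lt hre hz.1,
        hre.eventually_lt (hβ.comp tendsto_fst) hz.2] with p hp hp' using Or.inr ⟨hp, hp'⟩
  · by_cases him : z.im = 0
    · lift z to ℝ using him
      refine ofReal_mem_slitPlane.2 (mem_realIoo_of_frequently_subset hα hβ
        (Complex.continuous_ofReal.continuousAt hV) (hVW.mono fun n hn x hx => ?_))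
      exact ofReal_mem_slitPlane.1 (hn hx)
    · exact mem_slitPlane.2 (Or.inl him)

end SlitPlaneLimits

section UniformizationLimits

theorem tendstoLocallyUniformlyOn_pow_add {ι : Type*} {l : Filter ι} [l.NeBot] {P : ι → ℂ → ℂ}
    {p : ℂ → ℂ} {U : Set ℂ} {c : ι → ℂ} {c' : ℂ} (hU : IsOpen U)
    (hPp : TendstoLocallyUniformlyOn P p l U) (hp : ContinuousOn p U) (d : ℕ)
    (hc : Tendsto c l (𝓝 c')) :
    TendstoLocallyUniformlyOn (fun n z => P n z ^ d + c n) (fun z => p z ^ d + c') l U :=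
  tendstoLocallyUniformlyOn_of_tendsto_prod hU fun _ hz =>
    ((tendsto_prod_of_tendstoLocallyUniformlyOn hU hPp hp hz).pow d).add (hc.comp tendsto_fst)

variable {d : ℕ} {V : ℕ → Set ℂ} {V' : Set ℂ} {c : ℕ → ℂ} {c' : ℂ} {f ψ : ℕ → ℂ → ℂ}
  {G : ℕ → Set ℂ} {Ψ : ℂ → ℂ}

theorem kernelConverges_rootDomain (h : KernelConverges V V') (hV' : IsOpen V') (hd : d ≠ 0)
    (hc : Tendsto c atTop (𝓝 c')) :
    KernelConverges (fun n => rootDomain d (V n) (c n)) (rootDomain d V' c') := by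
  refine h.preimage hV' (F := fun n ζ => ζ ^ d + c n) (fun n => by fun_prop)
    (tendstoLocallyUniformlyOn_pow_add isOpen_univ (P := fun _ ζ => ζ) ?_ continuousOn_id d hc)
    fun z => eventually_ne_of_isPreconnected isOpen_univ isPreconnected_univ (by fun_prop)
      (mem_univ (0 : ℂ)) (mem_univ (1 : ℂ)) (by simp [hd]) (mem_univ z)
  exact fun u hu x _ => ⟨univ, univ_mem, Eventually.of_forall fun _ _ _ => refl_mem_uniformity hu⟩

theorem tendstoLocallyUniformlyOn_of_isUniformization (hV' : IsOpen V')
    (hW : CompactlyExhausts atTop (fun n => rootDomain d (V n) (c n)) (rootDomain d V' c'))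
    (hc : Tendsto c atTop (𝓝 c')) (hψ : ∀ n, IsUniformization d (f n) (G n) (V n) (c n) (ψ n))
    (hψΨ : TendstoLocallyUniformlyOn ψ Ψ atTop (rootDomain d V' c'))
    (hinj : InjOn Ψ (rootDomain d V' c')) :
    TendstoLocallyUniformlyOn f (fun z => Function.invFunOn Ψ (rootDomain d V' c') z ^ d + c')
      atTop (Ψ '' rootDomain d V' c') := by
  have hW'o : IsOpen (rootDomain d V' c') := isOpen_rootDomain hV'
  have hψd := fun n => (hψ n).differentiableOn
  have hΨd := differentiableOn_of_tendstoLocallyUniformlyOn hW'o hW hψd hψΨ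
  have hΨo : IsOpen (Ψ '' rootDomain d V' c') := isOpen_image_of_injOn hW'o hΨd hinj
  have hG : CompactlyExhausts atTop G (Ψ '' rootDomain d V' c') := by
    simpa only [(hψ _).image_eq] using hW.image hW'o hψd hψΨ hinj
  have hinv := differentiableOn_leftInvOn hW'o hΨd hinj.leftInvOn_invFunOn
  have hlim := tendstoLocallyUniformlyOn_pow_add hΨo
    (tendstoLocallyUniformlyOn_leftInvOn hW'o hW hψd hψΨ
      (fun n => (hψ n).injOn.leftInvOn_invFunOn) hinj.leftInvOn_invFunOn) hinv.continuousOn d hc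
  have hlimc : ContinuousOn (fun z => Function.invFunOn Ψ (rootDomain d V' c') z ^ d + c')
      (Ψ '' rootDomain d V' c') := (hinv.continuousOn.pow d).add continuousOn_const
  refine tendstoLocallyUniformlyOn_of_tendsto_prod hΨo fun z hz =>
    (tendsto_prod_of_tendstoLocallyUniformlyOn hΨo hlim hlimc hz).congr' ?_
  obtain ⟨K, hK, -, -, hKG⟩ := hG.exists_mem_nhds (hΨo.mem_nhds hz)
  filter_upwards [hKG.prod_mk hK] with p hp
  exact ((hψ p.1).eqOn_invFunOn_pow_add (hp.1 hp.2)).symm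

theorem convergesTo_of_isUniformization (hV : ∀ n, IsOpen (V n)) (hV' : IsOpen V')
    (hVV' : KernelConverges V V') (hc' : c' ∈ V') (hVc' : StarConvex ℝ c' V') (hd : d ≠ 0)
    (hc : Tendsto c atTop (𝓝 c')) (hψ : ∀ n, IsUniformization d (f n) (G n) (V n) (c n) (ψ n))
    (hψΨ : TendstoLocallyUniformlyOn ψ Ψ atTop (rootDomain d V' c'))
    (hinj : InjOn Ψ (rootDomain d V' c')) {u : ℕ → ℂ} {v : ℂ} (hu : Tendsto u atTop (𝓝 v))
    (hv : v ∈ Ψ '' rootDomain d V' c') :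
    ConvergesTo (fun n => ⟨G n, u n, f n⟩) ⟨Ψ '' rootDomain d V' c', v,
      fun z => Function.invFunOn Ψ (rootDomain d V' c') z ^ d + c'⟩ := by
  have hW := kernelConverges_rootDomain hVV' hV' hd hc
  have hW'o : IsOpen (rootDomain d V' c') := isOpen_rootDomain hV'
  have hψd := fun n => (hψ n).differentiableOn
  have hΨd := differentiableOn_of_tendstoLocallyUniformlyOn hW'o hW.exhausts hψd hψΨ
  have hG : KernelConverges G (Ψ '' rootDomain d V' c') := by
    simpa only [(hψ _).image_eq] using
      hW.image hW'o (fun n => isOpen_rootDomain (hV n)) hψd (fun n => (hψ n).injOn) hψΨ hinj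
  have hf := tendstoLocallyUniformlyOn_of_isUniformization hV' hW.exhausts hc hψ hψΨ hinj
  exact ⟨hG.caratheodoryConverges (isOpen_image_of_injOn hW'o hΨd hinj)
      ((isPreconnected_rootDomain hd hc' hVc').image Ψ hΨd.continuousOn) hu hv,
    fun L hL hLc => ⟨hG.exhausts L hL hLc,
      (tendstoLocallyUniformlyOn_iff_tendstoUniformlyOn_of_compact hLc).1 (hf.mono hL)⟩⟩

end UniformizationLimits

section RealUniformizationLimits

variable {d : ℕ} {f ψ : ℕ → ℂ → ℂ} {G : ℕ → Set ℂ} {J : ℕ → Set ℝ} {J' : Set ℝ} {c l : ℕ → ℝ}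
  {c' l' : ℝ} {Ψ : ℂ → ℂ}

theorem isRealUniformization_of_tendstoLocallyUniformlyOn (hJ' : IsOpen J')
    (hJc' : J'.OrdConnected) (hd : d ≠ 0) (hl' : 0 < l') (hsub : Icc c' (l' ^ d + c') ⊆ J')
    (hW : CompactlyExhausts atTop (fun n => rootDomain d (slitPlane (J n)) (c n))
      (rootDomain d (slitPlane J') c')) (hl : Tendsto l atTop (𝓝 l'))
    (hψ : ∀ n, IsRealUniformization d (f n) (G n) (J n) (c n) (l n) (ψ n))
    (hψΨ : TendstoLocallyUniformlyOn ψ Ψ atTop (rootDomain d (slitPlane J') c')) :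
    IsRealUniformization d
      (fun z => Function.invFunOn Ψ (rootDomain d (slitPlane J') c') z ^ d + c')
      (Ψ '' rootDomain d (slitPlane J') c') J' c' l' Ψ := by
  have hW'o : IsOpen (rootDomain d (slitPlane J') c') := isOpen_rootDomain (isOpen_slitPlane hJ')
  have hψd := fun n => (hψ n).differentiableOn
  have hΨd := differentiableOn_of_tendstoLocallyUniformlyOn hW'o hW hψd hψΨ
  have hmem := fun t ht => ofReal_mem_rootDomain_of_mem_Icc (t := t) hsub ht
  have hscaled : ∀ t ∈ Icc 0 l', Tendsto (fun n => ψ n ((t / l' * l n : ℝ) : ℂ)) atTop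
      (𝓝 (Ψ t)) := fun t ht => by
    refine (tendsto_prod_of_tendstoLocallyUniformlyOn hW'o hψΨ hΨd.continuousOn (hmem t ht)).comp
      (tendsto_id.prodMk ((Complex.continuous_ofReal.tendsto t).comp ?_))
    simpa [hl'.ne'] using hl.const_mul (t / l')
  have h0 : 0 = Ψ 0 := by
    simpa [(hψ _).map_zero] using hscaled 0 (left_mem_Icc.2 hl'.le)
  have h1 : 1 = Ψ l' := by
    simpa [hl'.ne', (hψ _).map_length] using hscaled l' (right_mem_Icc.2 hl'.le)
  have hc' : (c' : ℂ) ∈ slitPlane J' := ofReal_mem_slitPlane.2 (hsub (left_mem_Icc.2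
    (le_add_of_nonneg_left (by positivity))))
  have hinj : InjOn Ψ (rootDomain d (slitPlane J') c') :=
    injOn_of_tendstoLocallyUniformlyOn hW'o (isPreconnected_rootDomain hd hc'
      (starConvex_slitPlane hJc' (ofReal_mem_slitPlane.1 hc'))) hW hψd
      (fun n => (hψ n).injOn) hψΨ (zero_mem_rootDomain hd hc') (hmem l' (right_mem_Icc.2 hl'.le))
      (by simp [← h0, ← h1])
  refine ⟨isUniformization_invFunOn_pow_add hΨd hinj, h0.symm, h1.symm, fun t ht => ?_⟩
  refine tendsto_nhds_unique ((Complex.continuous_im.tendsto _).comp (hscaled t ht))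
    (tendsto_const_nhds.congr' ?_)
  filter_upwards [hl.eventually_const_lt hl'] with n hn
  refine ((hψ n).im_eq_zero _ ⟨?_, ?_⟩).symm
  · exact mul_nonneg (div_nonneg ht.1 hl'.le) hn.le
  · exact mul_le_of_le_one_left hn.le (div_le_one_of_le₀ ht.2 hl'.le)

theorem exists_subseq_isRealUniformization (hJ' : IsOpen J') (hJc' : J'.OrdConnected) (hd : d ≠ 0)
    (hl' : 0 < l') (hsub : Icc c' (l' ^ d + c') ⊆ J')
    (hJJ' : KernelConverges (fun n => slitPlane (J n)) (slitPlane J'))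
    (hc : Tendsto c atTop (𝓝 c')) (hl : Tendsto l atTop (𝓝 l'))
    (hψ : ∀ n, IsRealUniformization d (f n) (G n) (J n) (c n) (l n) (ψ n)) :
    ∃ φ : ℕ → ℕ, StrictMono φ ∧ ∃ Ψ : ℂ → ℂ,
      TendstoLocallyUniformlyOn (fun n => ψ (φ n)) Ψ atTop (rootDomain d (slitPlane J') c') ∧
      IsRealUniformization d
        (fun z => Function.invFunOn Ψ (rootDomain d (slitPlane J') c') z ^ d + c')
        (Ψ '' rootDomain d (slitPlane J') c') J' c' l' Ψ := by
  have hcC : Tendsto (fun n => (c n : ℂ)) atTop (𝓝 (c' : ℂ)) :=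
    (Complex.continuous_ofReal.tendsto c').comp hc
  have hlC : Tendsto (fun n => (l n : ℂ)) atTop (𝓝 (l' : ℂ)) :=
    (Complex.continuous_ofReal.tendsto l').comp hl
  have hW := (kernelConverges_rootDomain hJJ' (isOpen_slitPlane hJ') hd hcC).exhausts
  have hc' : c' ∈ J' := hsub (left_mem_Icc.2 (le_add_of_nonneg_left (by positivity)))
  have hcV' : (c' : ℂ) ∈ slitPlane J' := ofReal_mem_slitPlane.2 hc'
  have hW'o : IsOpen (rootDomain d (slitPlane J') c') := isOpen_rootDomain (isOpen_slitPlane hJ')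
  have hψd := fun n => (hψ n).differentiableOn
  obtain ⟨φ, hφ, Ψ, hψΨ⟩ := exists_subseq_tendstoLocallyUniformlyOn hW'o hW hψd fun z hz =>
    exists_mem_nhds_eventually_norm_le hW'o (isPreconnected_rootDomain hd hcV'
      (starConvex_slitPlane hJc' hc')) hW hψd (fun n => (hψ n).injOn) (M := 0) (N := 1)
      (zero_mem_rootDomain hd hcV') (by simp [(hψ _).map_zero]) hlC
      (ofReal_mem_rootDomain_of_mem_Icc hsub (right_mem_Icc.2 hl'.le))
      (by simp [(hψ _).map_length]) (by exact_mod_cast hl'.ne) hz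
  exact ⟨φ, hφ, Ψ, hψΨ, isRealUniformization_of_tendstoLocallyUniformlyOn hJ' hJc' hd hl' hsub
    (hW.comp hφ.tendsto_atTop) (hl.comp hφ.tendsto_atTop) (fun n => hψ (φ n)) hψΨ⟩

end RealUniformizationLimits

section EndpointBounds

namespace EndpointBounds

variable {s c d : ℝ} {J : Set ℝ}

theorem inv_sub_mem (h : EndpointBounds s c d J) : (d - c)⁻¹ ∈ Icc s s⁻¹ :=
  one_div (d - c) ▸ h.length

theorem lt (h : EndpointBounds s c d J) (hs : 0 < s) : c < d :=
  sub_pos.1 (inv_pos.1 (hs.trans_le h.inv_sub_mem.1))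

theorem le_sub (h : EndpointBounds s c d J) (hs : 0 < s) : s ≤ d - c :=
  (inv_le_inv₀ (sub_pos.2 (h.lt hs)) hs).1 h.inv_sub_mem.2

theorem sub_le (h : EndpointBounds s c d J) (hs : 0 < s) : d - c ≤ s⁻¹ :=
  (le_inv_comm₀ hs (sub_pos.2 (h.lt hs))).1 h.inv_sub_mem.1

theorem Icc_subset (h : EndpointBounds s c d J) (hs : 0 < s) : Icc c d ⊆ J := fun _ hx =>
  have hpos : 0 < s * (d - c) := mul_pos hs (sub_pos.2 (h.lt hs))
  h.space ⟨by linarith [hx.1], by linarith [hx.2]⟩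

theorem max_le (h : EndpointBounds s c d J) (hs : 0 < s) :
    max 0 (max (c - 1) (-d)) ≤ s⁻¹ * s⁻¹ :=
  ((div_le_iff₀ (sub_pos.2 (h.lt hs))).1 h.distance.2).trans (by gcongr; exact h.sub_le hs)

theorem left_mem_Icc (h : EndpointBounds s c d J) (hs : 0 < s) :
    c ∈ Icc (-(s⁻¹ * s⁻¹) - s⁻¹) (1 + s⁻¹ * s⁻¹) := by
  have hmax := h.max_le hs
  simp only [sup_le_iff] at hmax
  constructor <;> linarith [h.sub_le hs]

end EndpointBounds

variable {s c' d' : ℝ} {c d : ℕ → ℝ} {α β : ℕ → EReal} {α' β' : EReal}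

theorem endpointBounds_of_tendsto (hs : 0 < s) (hc : Tendsto c atTop (𝓝 c'))
    (hd : Tendsto d atTop (𝓝 d')) (hα : Tendsto α atTop (𝓝 α')) (hβ : Tendsto β atTop (𝓝 β'))
    (h : ∀ n, EndpointBounds s (c n) (d n) (realIoo (α n) (β n))) :
    EndpointBounds s c' d' (realIoo α' β') := by
  have hdc := hd.sub hc
  have hne : d' - c' ≠ 0 := (hs.trans_le (ge_of_tendsto' hdc fun n => (h n).le_sub hs)).ne'
  exact ⟨isClosed_Icc.mem_of_tendsto (tendsto_const_nhds.div hdc hne)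
      (Eventually.of_forall fun n => (h n).length),
    isClosed_Icc.mem_of_tendsto
      ((tendsto_const_nhds.max ((hc.sub_const 1).max hd.neg)).div hdc hne)
      (Eventually.of_forall fun n => (h n).distance),
    Ioo_subset_realIoo_of_tendsto hα hβ (hc.sub (hdc.const_mul s)) (hd.add (hdc.const_mul s))
      fun n => (h n).space⟩

theorem exists_subseq_tendsto_of_endpointBounds (hs : 0 < s) {l : ℕ → ℝ} (hl : ∀ n, 0 < l n)
    (h : ∀ n, EndpointBounds s (c n) (l n ^ 3 + c n) (realIoo (α n) (β n))) :
    ∃ φ : ℕ → ℕ, StrictMono φ ∧ ∃ c' l' : ℝ, ∃ α' β' : EReal,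
      Tendsto (c ∘ φ) atTop (𝓝 c') ∧ Tendsto (l ∘ φ) atTop (𝓝 l') ∧
      Tendsto (α ∘ φ) atTop (𝓝 α') ∧ Tendsto (β ∘ φ) atTop (𝓝 β') ∧
      0 < l' ∧ EndpointBounds s c' (l' ^ 3 + c') (realIoo α' β') := by
  have hlmem : ∀ n, l n ∈ Icc 0 (max 1 s⁻¹) := fun n => by
    have hcube : l n ^ 3 ≤ s⁻¹ := by simpa using (h n).sub_le hs
    refine ⟨(hl n).le, ?_⟩
    rcases le_total (l n) 1 with hl1 | hl1
    · exact le_max_of_le_left hl1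
    · exact le_max_of_le_right ((le_self_pow₀ hl1 three_ne_zero).trans hcube)
  obtain ⟨⟨c', l', α', β'⟩, -, φ, hφ, hlim⟩ := (isCompact_Icc.prod (isCompact_Icc.prod
    (isCompact_univ (X := EReal × EReal)))).tendsto_subseq
    (x := fun n => (c n, l n, α n, β n)) fun n => ⟨(h n).left_mem_Icc hs, hlmem n, mem_univ _⟩
  simp only [nhds_prod_eq, tendsto_prod_iff'] at hlim
  obtain ⟨hc, hl', hα, hβ⟩ := hlim
  have hbounds := endpointBounds_of_tendsto hs hc ((hl'.pow 3).add hc) hα hβ fun n => h (φ n)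
  refine ⟨φ, hφ, c', l', α', β', hc, hl', hα, hβ, ?_, hbounds⟩
  exact (Odd.pow_pos_iff (by decide)).1 (pos_of_lt_add_left (hbounds.lt hs))

end EndpointBounds

section Compactness

variable {g : ℝ → ℝ} {J : Set ℝ} {G : Set ℂ} {f : ℂ → ℂ} {s : ℝ}

theorem IsEpsteinMap.apply_zero_lt (h : IsEpsteinMap 1 g J G f) : g 0 < g 1 :=
  h.strictMono left_mem_uIcc right_mem_uIcc zero_lt_one

theorem IsEpsteinMap.image_eq (h : IsEpsteinMap 1 g J G f) :
    g '' uIcc 0 1 = Icc (g 0) (g 1) := by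
  rw [h.continuousOn.image_uIcc_of_monotoneOn h.strictMono.monotoneOn,
    uIcc_of_le h.apply_zero_lt.le]

theorem IsEpsteinMap.derivWithin_eq (h : IsEpsteinMap 1 g J G f) :
    derivWithin g (uIcc 0 1) 1 = (deriv f 1).re := by
  have h1 : ((1 : ℝ) : ℂ) ∈ G := h.subset_dom 1 right_mem_uIcc
  have hf := (h.covering.analytic.differentiableAt (h.isOpen_dom.mem_nhds h1)).hasDerivAt
  have hg : ∀ x ∈ uIcc (0 : ℝ) 1, g x = (f x).re := fun x hx => by
    rw [h.extends_map x hx, Complex.ofReal_re]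
  have hunique : UniqueDiffWithinAt ℝ (uIcc (0 : ℝ) 1) 1 := by
    rw [uIcc_of_le zero_le_one]
    exact uniqueDiffOn_Icc_zero_one 1 (right_mem_Icc.2 zero_le_one)
  simpa using ((hf.real_of_complex.hasDerivWithinAt.congr hg (hg 1 right_mem_uIcc)).derivWithin
    hunique)

theorem IsEpsteinMap.hasBounds_iff (h : IsEpsteinMap 1 g J G f) :
    HasBounds s 1 g J ↔ EndpointBounds s (g 0) (g 1) J :=
  Epstein.hasBounds_iff h.isOpen_range h.interval_range h.apply_zero_lt.le h.image_eq
    (h.image_eq ▸ h.image_subset)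

theorem mem_closedEpsteinClass_iff (hs : 0 < s) {T : MarkedMap} :
    T ∈ closedEpsteinClass s 1 ↔ T.pt = 0 ∧ ∃ (α β : EReal) (c l : ℝ) (ψ : ℂ → ℂ), 0 < l ∧
      EndpointBounds s c (l ^ 3 + c) (realIoo α β) ∧
      IsRealUniformization 3 T.map T.dom (realIoo α β) c l ψ ∧ s ≤ (deriv T.map 1).re := by
  refine and_congr_right fun _ => ⟨?_, ?_⟩
  · rintro ⟨g, J, hg, hbounds, hderiv⟩
    obtain ⟨α, β, rfl⟩ := exists_eq_realIoo hg.isOpen_range hg.interval_range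
    have hlt : 0 < g 1 - g 0 := sub_pos.2 hg.apply_zero_lt
    have hl : ((g 1 - g 0) ^ ((3 : ℕ) : ℝ)⁻¹) ^ 3 = g 1 - g 0 :=
      Real.rpow_inv_natCast_pow hlt.le three_ne_zero
    have hpos := Real.rpow_pos_of_pos hlt ((3 : ℕ) : ℝ)⁻¹
    obtain ⟨ψ, hψ⟩ := hg.exists_isRealUniformization hpos hl
    refine ⟨α, β, g 0, _, ψ, hpos, ?_, hψ, hg.derivWithin_eq ▸ hderiv⟩
    rw [hl, sub_add_cancel]
    exact hg.hasBounds_iff.1 hbounds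
  · rintro ⟨α, β, c, l, ψ, hl, hbounds, hψ, hderiv⟩
    have hsub := hbounds.Icc_subset hs
    have hg := hψ.isEpsteinMap (isOpen_realIoo α β) (ordConnected_realIoo α β) hl.le hsub
    refine ⟨_, _, hg, hg.hasBounds_iff.2 ?_, hg.derivWithin_eq ▸ hderiv⟩
    have h0 := hψ.map_apply_ofReal hsub (left_mem_Icc.2 hl.le)
    have h1 := hψ.map_apply_ofReal hsub (right_mem_Icc.2 hl.le)
    simp only [Complex.ofReal_zero, hψ.map_zero, hψ.map_length] at h0 h1
    simpa [h0, h1, -Complex.ofReal_add, -Complex.ofReal_pow] using hbounds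

theorem epsteinClass_subset_closedEpsteinClass (s a : ℝ) :
    epsteinClass s a ⊆ closedEpsteinClass s a := fun _ ⟨hpt, g, J, hg, hbounds, hderiv⟩ =>
  ⟨hpt, g, J, hg, hbounds, hderiv.le⟩

theorem ConvergesTo.tendsto_deriv {T : ℕ → MarkedMap} {S : MarkedMap} {z : ℂ}
    (h : ConvergesTo T S) (hS : IsOpen S.dom)
    (hT : ∀ n, DifferentiableOn ℂ (T n).map (T n).dom) (hz : z ∈ S.dom) :
    Tendsto (fun n => deriv (T n).map z) atTop (𝓝 (deriv S.map z)) :=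
  tendsto_deriv_of_tendstoLocallyUniformlyOn hS (fun L hL hLc => (h.2 L hL hLc).1) hT
    ((tendstoLocallyUniformlyOn_iff_forall_isCompact hS).2 fun L hL hLc => (h.2 L hL hLc).2) hz

theorem exists_subseq_convergesTo (hs : 0 < s) {T : ℕ → MarkedMap}
    (hT : ∀ n, T n ∈ closedEpsteinClass s 1) :
    ∃ S ∈ closedEpsteinClass s 1, ∃ φ : ℕ → ℕ, StrictMono φ ∧ ConvergesTo (T ∘ φ) S := by
  simp only [mem_closedEpsteinClass_iff hs] at hT
  choose hpt α β c l ψ hl hbounds hψ hderiv using hT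
  obtain ⟨φ, hφ, c', l', α', β', hc, hl', hα, hβ, hl'_pos, hbounds'⟩ :=
    exists_subseq_tendsto_of_endpointBounds hs hl hbounds
  have hJ' := isOpen_realIoo α' β'
  have hJc' := ordConnected_realIoo α' β'
  have hsub := hbounds'.Icc_subset hs
  have hker := kernelConverges_slitPlane_realIoo hα hβ
  obtain ⟨χ, hχ, Ψ, hψΨ, hΨ⟩ := exists_subseq_isRealUniformization hJ' hJc' three_ne_zero
    hl'_pos hsub hker hc hl' fun n => hψ (φ n)
  have hcχ := (Complex.continuous_ofReal.tendsto c').comp (hc.comp hχ.tendsto_atTop)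
  have hψχ := fun n => (hψ (φ (χ n))).toIsUniformization
  have hc'J : c' ∈ realIoo α' β' := hsub (left_mem_Icc.2 (hbounds'.lt hs).le)
  have hconv : ConvergesTo (T ∘ φ ∘ χ) ⟨Ψ '' _, 0, _⟩ :=
    convergesTo_of_isUniformization (fun n => isOpen_slitPlane (isOpen_realIoo _ _))
      (isOpen_slitPlane hJ') (hker.comp hχ.tendsto_atTop) (ofReal_mem_slitPlane.2 hc'J)
      (starConvex_slitPlane hJc' hc'J) three_ne_zero hcχ hψχ hψΨ hΨ.injOn
      (tendsto_const_nhds.congr fun n => (hpt (φ (χ n))).symm)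
      ⟨0, zero_mem_rootDomain three_ne_zero (ofReal_mem_slitPlane.2 hc'J), hΨ.map_zero⟩
  refine ⟨_, (mem_closedEpsteinClass_iff hs).2
    ⟨rfl, α', β', c', l', Ψ, hl'_pos, hbounds', hΨ, ?_⟩, φ ∘ χ, hφ.comp hχ, hconv⟩
  have h1 : (1 : ℂ) ∈ Ψ '' rootDomain 3 (slitPlane (realIoo α' β')) c' :=
    ⟨l', ofReal_mem_rootDomain_of_mem_Icc hsub (right_mem_Icc.2 hl'_pos.le), hΨ.map_length⟩
  have hlim := hconv.tendsto_deriv (hΨ.isOpen_image (isOpen_slitPlane hJ'))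
    (fun n => (hψχ n).differentiableOn_map (isOpen_slitPlane (isOpen_realIoo _ _))) h1
  exact ge_of_tendsto' ((Complex.continuous_re.tendsto _).comp hlim) fun n => hderiv (φ (χ n))

end Compactness

end Epstein

theorem mainTheorem5 (s : ℝ) (hs₀ : 0 < s) (hs₁ : s < 1) :
    (∀ T : ℕ → Epstein.MarkedMap, (∀ n, T n ∈ Epstein.epsteinClass s 1) →
      ∃ S ∈ Epstein.closedEpsteinClass s 1, ∃ φ : ℕ → ℕ,
        StrictMono φ ∧ Epstein.ConvergesTo (T ∘ φ) S) ∧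
    (∀ T : ℕ → Epstein.MarkedMap, (∀ n, T n ∈ Epstein.closedEpsteinClass s 1) →
      ∃ S ∈ Epstein.closedEpsteinClass s 1, ∃ φ : ℕ → ℕ,
        StrictMono φ ∧ Epstein.ConvergesTo (T ∘ φ) S) :=
  ⟨fun _ hT => Epstein.exists_subseq_convergesTo hs₀ fun n =>
      Epstein.epsteinClass_subset_closedEpsteinClass s 1 (hT n),
    fun _ hT => Epstein.exists_subseq_convergesTo hs₀ hT⟩
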